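/- **Definitions.** Let $Q$ be a finite set. Configurations are finite multisets. A *cube* over $Q$ is a set of multisets $\{C : L\le C\le U\}$ with $L:Q\to\mathbb N$, $U:Q\to\mathbb N\cup\{\infty\}$; its norm is the maximum of $\sum_q L(q)$ and the sum of the finite values of $U$. A *counting set* is a finite union of cubes; its norm $\|S\|$ is the minimum, over all representations of $S$ as a finite union of cubes, of the maximal norm of the cubes (the maximum over no cubes is $0$). For a step relation $\to$, $\mathrm{post}^*(S)$ (resp. $\mathrm{pre}^*(S)$) is the set of configurations reachable from (resp. that can reach) an element of $S$. A *reconfigurable broadcast network* (RBN) is $\mathcal R=(Q,\Sigma,\delta)$ with $Q,\Sigma$ finite and $\delta\subseteq Q\times\{!a,?a\mid a\in\Sigma\}\times Q$; configurations are multisets over $Q$; in a step, one process takes a transition $p\xrightarrow{!a}q$ and, simultaneously, any number $k\ge 0$ of other processes take transitions $p_i\xrightarrow{?a}q_i$. An *asynchronous shared-memory system* (ASMS) is $(Q,\Sigma,\delta)$ with $Q,\Sigma$ finite and $\delta\subseteq Q\times\{R,W\}\times\Sigma\times Q$; configurations are pairs $(M,d)$ with $M$ a multiset over $Q$ and $d\in\Sigma$,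 regarded as multisets over the disjoint union $Q\sqcup\Sigma$ (its *places*); in a step one process takes a transition $(p,R,d,q)$, which requires the register value to be $d$ and keeps it, or $(p,W,d',q)$, which sets the register to $d'$. An *immediate observation (IO) net* is $(Q,\delta)$ with $Q$ finite and $\delta\subseteq Q\times Q\times Q$; configurations are multisets over $Q$; a transition $(p,q,p')$ can be taken from $C\ge\{p,q\}$ (as multisets) and leads to $C-\{p\}+\{p'\}$. The places of an RBN or an IO net are its states. The size of an instance is $|Q|+|\Sigma|+|\delta|$ (without $|\Sigma|$ for IO nets). An instance $J$ *strongly simulates* an instance $I$ through $h$ if the places of $I$ are included in those of $J$, $h$ is a multiset over the places of $J$ not in $I$, $C\cdot h$ is a configuration of $J$ for every configuration $C$ of $I$, and $C'\in\mathrm{post}^*(C)\iff C'\cdot h\in\mathrm{post}^*(C\cdot h)$ for all configurations $C,C'$ of $I$, where $C\cdot h$ is the multiset equal to $C$ on the places of $I$ and to $h$ on the others. A model $B$ *strongly simulates* a model $A$ if there is a polynomial $p$ such that every instance $I$ of $A$ is strongly simulated by some instance $J$ of $B$ through some $h$ with $|J|\le p(|I|)$ and $|h|\le p(|I|)$. For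 $n\ge1$ let $\mathcal R_n$ be the RBN with states $tok$, $sent$, $a_i,b_i,c_i$ ($1\le i\le n$), letters $1,\dots,n+1$ and transitions $tok\xrightarrow{!1}sent$ and $a_i\xrightarrow{?i}b_i$, $b_i\xrightarrow{?i}c_i$, $c_i\xrightarrow{!(i+1)}a_i$ for $1\le i\le n$. Let $\mathcal C_0$ be the cube of configurations with arbitrarily many processes in $tok$, exactly one in each $a_i$ and none elsewhere, and $\mathcal C_f$ the cube of configurations with at least one process in $c_n$. **Theorem.** 1. If IO nets strongly simulate RBN, then there are constants $c,k$ such that for every RBN $\mathcal R$ with state set $Q$ and every counting set $S$ of $\mathcal R$, $\mathrm{post}^*(S)$ and $\mathrm{pre}^*(S)$ are counting sets of norm at most $c\,(\|S\|+|Q|)^k$. 2. Moreover, unconditionally, there are constants $c,k$ such that whenever a single RBN $\mathcal R$ is strongly simulated by an IO net $\mathcal N$ with state set $Q_{\mathcal N}$ through $h$, then for every counting set $S$ of $\mathcal R$, $\mathrm{post}^*(S)$ and $\mathrm{pre}^*(S)$ are counting sets of norm at most $c\,(\|S\|+|h|+|Q_{\mathcal N}|)^k$. 3. For all $n\ge1$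 and $m\ge0$: some configuration of $\mathcal C_0$ with exactly $m$ processes in $tok$ reaches a configuration of $\mathcal C_f$ in $\mathcal R_n$ if and only if $m\ge2^n$. 4. For all constants $c,k$ there is $n\ge1$ such that in $\mathcal R_n$, with state set $Q$, the set $\mathrm{post}^*(\mathcal C_0)$ is not a counting set of norm at most $c\,(\|\mathcal C_0\|+|Q|)^k$. 5. IO nets do not strongly simulate RBN, and IO nets do not strongly simulate ASMS. -/

import Mathlib

/-! ### Transition systems, cubes and counting sets -/

/-- `post*`: everything reachable from `S` by the reflexive-transitive closure of `step`. -/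
def postStar {α : Type} (step : α → α → Prop) (S : Set α) : Set α :=
  {C | ∃ C' ∈ S, Relation.ReflTransGen step C' C}

/-- `pre*`: everything that can reach `S`. -/
def preStar {α : Type} (step : α → α → Prop) (S : Set α) : Set α :=
  {C' | ∃ C ∈ S, Relation.ReflTransGen step C' C}

/-- A cube over `Q`, given by lower bounds and (possibly infinite) upper bounds. -/
structure Cube (Q : Type) where
  lower : Q → ℕ
  upper : Q → ℕ∞

namespace Cube

open Classical in
/-- The set of multisets `C` with `lower ≤ C ≤ upper`. -/
def toSet {Q : Type} (K : Cube Q) : Set (Multiset Q) :=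
  {C | ∀ q, K.lower q ≤ C.count q ∧ (C.count q : ℕ∞) ≤ K.upper q}

/-- Sum of the lower bounds. -/
def lnorm {Q : Type} [Fintype Q] (K : Cube Q) : ℕ := ∑ q, K.lower q

/-- Sum of the finite upper bounds (`ENat.toNat ⊤ = 0`, so infinite bounds contribute nothing). -/
def unorm {Q : Type} [Fintype Q] (K : Cube Q) : ℕ := ∑ q, (K.upper q).toNat

def norm {Q : Type} [Fintype Q] (K : Cube Q) : ℕ := max K.lnorm K.unorm

end Cube

/-- A counting constraint: a finite union of cubes, given as the list of these cubes. -/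
abbrev CountingConstraint (Q : Type) := List (Cube Q)

namespace CountingConstraint

/-- The set of configurations that a counting constraint describes. -/
def toSet {Q : Type} (Γ : CountingConstraint Q) : Set (Multiset Q) :=
  {C | ∃ K ∈ Γ, C ∈ K.toSet}

/-- The maximum of the norms of the cubes (`0` for the empty union). -/
def norm {Q : Type} [Fintype Q] (Γ : CountingConstraint Q) : ℕ :=
  (Γ.map Cube.norm).foldr max 0

end CountingConstraint

def IsCountingSet {Q : Type} (S : Set (Multiset Q)) : Prop :=
  ∃ Γ : CountingConstraint Q, CountingConstraint.toSet Γ = S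

/-- The norm of a counting set: the smallest norm of a counting constraint describing it.
It is only meaningful together with `IsCountingSet S`. -/
noncomputable def countingNorm {Q : Type} [Fintype Q] (S : Set (Multiset Q)) : ℕ :=
  sInf {m | ∃ Γ : CountingConstraint Q,
    CountingConstraint.toSet Γ = S ∧ CountingConstraint.norm Γ = m}

/-- `S` is a counting set of norm at most `m`. -/
def IsCountingSetOfNormLE {Q : Type} [Fintype Q] (S : Set (Multiset Q)) (m : ℕ) : Prop :=
  IsCountingSet S ∧ countingNorm S ≤ m

/-! ### Systems of anonymous processes and strong simulation -/

/-- What the comparison of the three models uses of an instance: its places (states, and for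
shared memory also register values), which multisets of places are configurations, the step
relation, and the size of the description of the instance. -/
structure ProcessSystem where
  Place : Type
  IsConfig : Multiset Place → Prop
  Step : Multiset Place → Multiset Place → Prop
  size : ℕ

/-- `J` strongly simulates `I` through the inclusion `f` of the places of `I` into those of `J`
and the multiset `h` over the remaining places of `J`; the multiset `C.map f + h` is `C · h`. -/
def IsStrongSimulation (I J : ProcessSystem) (f : I.Place ↪ J.Place)
    (h : Multiset J.Place) : Prop :=
  (∀ x, f x ∉ h) ∧
  (∀ C, I.IsConfig C → J.IsConfig (C.map f + h)) ∧
  ∀ C C', I.IsConfig C → I.IsConfig C' →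
    (C' ∈ postStar I.Step {C} ↔ C'.map f + h ∈ postStar J.Step {C.map f + h})

/-- The model `B` strongly simulates the model `A` (a model is a class of systems): for some
polynomial `p`, every instance `I` of `A` is strongly simulated by an instance `J` of `B` through
a multiset `h`, the sizes of `J` and of `h` being at most `p (size of I)`. -/
def StronglySimulates (B A : Set ProcessSystem) : Prop :=
  ∃ p : Polynomial ℕ, ∀ I ∈ A, ∃ J ∈ B, ∃ (f : I.Place ↪ J.Place) (h : Multiset J.Place),
    IsStrongSimulation I J f h ∧ J.size ≤ p.eval I.size ∧ h.card ≤ p.eval I.size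

/-! ### Reconfigurable broadcast networks -/

inductive BroadcastAction (A : Type) where
  | send (a : A)
  | recv (a : A)

structure RBN where
  State : Type
  Letter : Type
  [fintypeState : Fintype State]
  [fintypeLetter : Fintype Letter]
  δ : Set (State × BroadcastAction Letter × State)

namespace RBN

attribute [instance] RBN.fintypeState RBN.fintypeLetter

/-- A process at `p` broadcasts `a` and moves to `q`; for every pair `(pᵢ, qᵢ)` in `ts` a further
process at `pᵢ` receives `a` and moves to `qᵢ`; the processes in `D` do not move. -/
def Step (R : RBN) (C C' : Multiset R.State) : Prop :=
  ∃ (a : R.Letter) (p q : R.State) (ts : Multiset (R.State × R.State)) (D : Multiset R.State),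
    (p, BroadcastAction.send a, q) ∈ R.δ ∧
    (∀ t ∈ ts, (t.1, BroadcastAction.recv a, t.2) ∈ R.δ) ∧
    C = {p} + ts.map Prod.fst + D ∧
    C' = {q} + ts.map Prod.snd + D

noncomputable def toSystem (R : RBN) : ProcessSystem where
  Place := R.State
  IsConfig := fun _ => True
  Step := R.Step
  size := Fintype.card R.State + Fintype.card R.Letter + R.δ.ncard

end RBN

def rbnModel : Set ProcessSystem := Set.range RBN.toSystem

/-! ### Asynchronous shared-memory systems -/

inductive RegisterOp where
  | read
  | write

structure ASMS where
  State : Type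
  Letter : Type
  [fintypeState : Fintype State]
  [fintypeLetter : Fintype Letter]
  δ : Set (State × RegisterOp × Letter × State)

namespace ASMS

attribute [instance] ASMS.fintypeState ASMS.fintypeLetter

/-- The configuration `(M, d)`, as a multiset over the disjoint union of states and letters. -/
def config (P : ASMS) (M : Multiset P.State) (d : P.Letter) : Multiset (P.State ⊕ P.Letter) :=
  M.map Sum.inl + {Sum.inr d}

/-- One process moves from `p` to `q`, reading the register value or overwriting it; the
processes in `D` do not move. -/
def Step (P : ASMS) (C C' : Multiset (P.State ⊕ P.Letter)) : Prop :=
  ∃ (p q : P.State) (d d' : P.Letter) (D : Multiset P.State),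
    C = P.config ({p} + D) d ∧ C' = P.config ({q} + D) d' ∧
    (((p, RegisterOp.read, d, q) ∈ P.δ ∧ d' = d) ∨ (p, RegisterOp.write, d', q) ∈ P.δ)

noncomputable def toSystem (P : ASMS) : ProcessSystem where
  Place := P.State ⊕ P.Letter
  IsConfig := fun C => ∃ M d, C = P.config M d
  Step := P.Step
  size := Fintype.card P.State + Fintype.card P.Letter + P.δ.ncard

end ASMS

def asmsModel : Set ProcessSystem := Set.range ASMS.toSystem

/-! ### Immediate observation nets -/

structure IONet where
  State : Type
  [fintypeState : Fintype State]
  δ : Set (State × State × State)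

namespace IONet

attribute [instance] IONet.fintypeState

/-- A process at `p` observes another process at `q` and moves to `p'`. -/
def Step (N : IONet) (C C' : Multiset N.State) : Prop :=
  ∃ (p q p' : N.State) (D : Multiset N.State),
    (p, q, p') ∈ N.δ ∧ C = {p} + {q} + D ∧ C' = {p'} + {q} + D

noncomputable def toSystem (N : IONet) : ProcessSystem where
  Place := N.State
  IsConfig := fun _ => True
  Step := N.Step
  size := Fintype.card N.State + N.δ.ncard

end IONet

def ioModel : Set ProcessSystem := Set.range IONet.toSystem

/-! ### The counter to `2 ^ n` -/

inductive CounterState (n : ℕ) where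
  | tok
  | sent
  | a (i : Fin n)
  | b (i : Fin n)
  | c (i : Fin n)
deriving DecidableEq, Fintype

/-- Transitions of the counter. The letters `1, …, n + 1` are represented by `Fin (n + 1)`, and
the indices `1, …, n` of the states by `Fin n`, both shifted to start at `0`. -/
inductive CounterTrans (n : ℕ) :
    CounterState n × BroadcastAction (Fin (n + 1)) × CounterState n → Prop
  | tok : CounterTrans n (.tok, .send 0, .sent)
  | ab (i : Fin n) : CounterTrans n (.a i, .recv i.castSucc, .b i)
  | bc (i : Fin n) : CounterTrans n (.b i, .recv i.castSucc, .c i)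
  | ca (i : Fin n) : CounterTrans n (.c i, .send i.succ, .a i)

/-- The network `R_n`. -/
abbrev counterRBN (n : ℕ) : RBN where
  State := CounterState n
  Letter := Fin (n + 1)
  δ := {t | CounterTrans n t}

/-- Arbitrarily many processes in `tok`, exactly one in each `a i`, none elsewhere. -/
def counterInit (n : ℕ) : Cube (CounterState n) where
  lower
    | .a _ => 1
    | _ => 0
  upper
    | .tok => ⊤
    | .a _ => 1
    | _ => 0

/-- At least one process in the last `c i` (the state `c_n`), arbitrarily many elsewhere. -/
def counterFinal (n : ℕ) : Cube (CounterState n) where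
  lower
    | .c i => if i.val + 1 = n then 1 else 0
    | _ => 0
  upper := fun _ => ⊤

/-!
Immediate observation nets have small reachability sets. A run is a family of trajectories of
single processes, and what a transition needs of the other processes is only that somebody waits at
the observed state. Among the trajectories with given ends, one for each state `x` (reach `x` with
the first visitor, wait, leave with the last visitor) already cover all waiting that the family
does. Hence, in the matrix counting the processes that go from `s` to `e`, every entry that is at
least the number of states may be replaced by any other such number (`IONet.exists_flow`).
It follows that a configuration in `pre*` of a cube lies in a cube of polynomial norm inside that
`pre*` (`IONet.exists_cube_subset_preStar`); since only finitely many cubes have a given norm, this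
bounds the norm of `pre*` of every counting set, and `post*` is `pre*` of the reversed net. Adding
the fixed part `h` and slicing it off again transfers the bound to every system that such a net
strongly simulates (`IsStrongSimulation.exists_isCountingSetOfNormLE`).

The counter violates such bounds. Moving the process of level `i` from `a` to `c` takes two
broadcasts of level `i`, so one broadcast of level `i` is worth `2 ^ i` tokens. No two processes
share a level, hence a broadcast reaches at most one receiver and the total worth never exceeds the
number of tokens sent (`counterRBN_weight_le`); a recursive run attains the bound
(`counterRBN_broadcast`). A counting constraint of norm below `2 ^ n` could not tell `2 ^ n` tokens
sent from `2 ^ n - 1`, which bounds the norm of `post*` from below. The same counter with messages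
passed through a register, where a reader blanks the register before it waits for its second
message, treats shared memory.

The first implication assumes that immediate observation nets strongly simulate broadcast networks,
and it follows from the refutation of this assumption. The transfer to a single network alone would
only bound the norms in terms of the whole size of that network, and the number of letters is not
polynomially bounded in the number of states.
-/

/-! ### Counting sets -/

theorem Cube.mem_toSet {Q : Type} [DecidableEq Q] {K : Cube Q} {C : Multiset Q} :
    C ∈ K.toSet ↔ ∀ q, K.lower q ≤ C.count q ∧ (C.count q : ℕ∞) ≤ K.upper q := by
  unfold Cube.toSet
  rw [Set.mem_ofPred_eq]
  convert Iff.rfl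

theorem CountingConstraint.norm_le_iff {Q : Type} [Fintype Q] {Γ : CountingConstraint Q} {m : ℕ} :
    CountingConstraint.norm Γ ≤ m ↔ ∀ K ∈ Γ, K.norm ≤ m := by
  unfold CountingConstraint.norm
  induction Γ with
  | nil => simp
  | cons K Γ ih => simp [ih]

theorem Cube.finite_setOf_norm_le {Q : Type} [Fintype Q] (m : ℕ) :
    {K : Cube Q | K.norm ≤ m}.Finite := by
  have hu : {u : ℕ∞ | u.toNat ≤ m}.Finite := by
    refine ((((Set.finite_Iic m).image ((↑) : ℕ → ℕ∞))).insert ⊤).subset fun u hu => ?_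
    induction u using ENat.recTopCoe with
    | top => simp
    | coe a => exact Or.inr ⟨a, by simpa using hu, rfl⟩
  have hfin := (Set.Finite.pi' fun _ : Q => Set.finite_Iic m).prod (Set.Finite.pi' fun _ : Q => hu)
  refine (hfin.image fun x => (⟨x.1, x.2⟩ : Cube Q)).subset fun K hK => ?_
  have hK' := max_le_iff.1 (show max K.lnorm K.unorm ≤ m from hK)
  refine ⟨(K.lower, K.upper), ⟨fun q => ?_, fun q => ?_⟩, rfl⟩
  · exact (Finset.single_le_sum (f := K.lower) (fun _ _ => Nat.zero_le _)
      (Finset.mem_univ q)).trans hK'.1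
  · exact (Finset.single_le_sum (f := fun q => (K.upper q).toNat) (fun _ _ => Nat.zero_le _)
      (Finset.mem_univ q)).trans hK'.2

/-- Being a counting set of bounded norm is a local property: only finitely many cubes have norm
at most `m`, so it suffices to surround every element of the set by one of them. -/
theorem isCountingSetOfNormLE_iff {Q : Type} [Fintype Q] {S : Set (Multiset Q)} {m : ℕ} :
    IsCountingSetOfNormLE S m ↔ ∀ C ∈ S, ∃ K : Cube Q, K.norm ≤ m ∧ C ∈ K.toSet ∧ K.toSet ⊆ S := by
  constructor
  · rintro ⟨⟨Γ₀, hΓ₀⟩, hm⟩ C hC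
    obtain ⟨Γ, hΓ, hn⟩ := Nat.sInf_mem (⟨_, Γ₀, hΓ₀, rfl⟩ :
      {m | ∃ Γ : CountingConstraint Q, Γ.toSet = S ∧ CountingConstraint.norm Γ = m}.Nonempty)
    have hn' : CountingConstraint.norm Γ ≤ m := hn.le.trans hm
    rw [← hΓ] at hC
    obtain ⟨K, hK, hCK⟩ := hC
    refine ⟨K, CountingConstraint.norm_le_iff.1 hn' K hK, hCK, fun D hD => ?_⟩
    rw [← hΓ]
    exact ⟨K, hK, hD⟩
  · intro h
    have hfin : {K : Cube Q | K.norm ≤ m ∧ K.toSet ⊆ S}.Finite :=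
      (Cube.finite_setOf_norm_le m).subset fun K hK => hK.1
    have hmem : ∀ K, K ∈ hfin.toFinset.toList ↔ K.norm ≤ m ∧ K.toSet ⊆ S := by simp
    have hset : CountingConstraint.toSet hfin.toFinset.toList = S := by
      ext C
      constructor
      · rintro ⟨K, hK, hC⟩
        exact ((hmem K).1 hK).2 hC
      · intro hC
        obtain ⟨K, hK, hCK, hKS⟩ := h C hC
        exact ⟨K, (hmem K).2 ⟨hK, hKS⟩, hCK⟩
    have hle : countingNorm S ≤ CountingConstraint.norm hfin.toFinset.toList :=
      Nat.sInf_le ⟨_, hset, rfl⟩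
    exact ⟨⟨_, hset⟩, hle.trans
      (CountingConstraint.norm_le_iff.2 fun K hK => ((hmem K).1 hK).1)⟩

theorem IsCountingSetOfNormLE.mono {Q : Type} [Fintype Q] {S : Set (Multiset Q)} {m m' : ℕ}
    (h : IsCountingSetOfNormLE S m) (hm : m ≤ m') : IsCountingSetOfNormLE S m' :=
  ⟨h.1, h.2.trans hm⟩

theorem IsCountingSet.normLE {Q : Type} [Fintype Q] {S : Set (Multiset Q)} (h : IsCountingSet S) :
    IsCountingSetOfNormLE S (countingNorm S) :=
  ⟨h, le_rfl⟩

theorem Cube.isCountingSetOfNormLE {Q : Type} [Fintype Q] (K : Cube Q) :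
    IsCountingSetOfNormLE K.toSet K.norm :=
  isCountingSetOfNormLE_iff.2 fun _ hC => ⟨K, le_rfl, hC, subset_rfl⟩

theorem Multiset.count_sum_nsmul_singleton {ι Q : Type} [Fintype ι] [DecidableEq Q] (G : ι → ℕ)
    (g : ι → Q) (q : Q) :
    (∑ x, G x • ({g x} : Multiset Q)).count q = ∑ x, if g x = q then G x else 0 := by
  rw [Multiset.count_sum']
  refine Finset.sum_congr rfl fun x _ => ?_
  rw [Multiset.count_nsmul, Multiset.count_singleton]
  by_cases h : g x = q
  · simp [h]
  · simp [h, Ne.symm h]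

/-! ### Histories of immediate observation nets -/

namespace IONet

/-- A multiset of trajectories of single processes over the times `0, …, T` that comes from a run
of `N`: between consecutive times every process waits or takes one common transition `(p, q, p')`,
and some process waits at the observed state `q`. -/
def IsHistory (N : IONet) (T : ℕ) (X : Multiset (ℕ → N.State)) : Prop :=
  ∀ i < T, ∃ p q p', (p, q, p') ∈ N.δ ∧
    (∀ τ ∈ X, τ (i + 1) = τ i ∨ τ i = p ∧ τ (i + 1) = p') ∧ ∃ τ ∈ X, τ i = q ∧ τ (i + 1) = q

/-- Any number of processes can take the same transition one after the other. -/
theorem reach_of_common_move (N : IONet) {p q p' : N.State} (h : (p, q, p') ∈ N.δ)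
    (Y : Multiset (N.State × N.State)) (hY : ∀ y ∈ Y, y.2 = y.1 ∨ y.1 = p ∧ y.2 = p')
    (D : Multiset N.State) :
    Relation.ReflTransGen N.Step ({q} + Y.map Prod.fst + D) ({q} + Y.map Prod.snd + D) := by
  induction Y using Multiset.induction_on generalizing D with
  | empty => exact .refl
  | cons y Y ih =>
    have h1 := ih (fun z hz => hY z (Multiset.mem_cons_of_mem hz)) ({y.1} + D)
    have e1 : {q} + (y ::ₘ Y).map Prod.fst + D = {q} + Y.map Prod.fst + ({y.1} + D) := by
      rw [Multiset.map_cons, ← Multiset.singleton_add]; abel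
    have e2 : {q} + (y ::ₘ Y).map Prod.snd + D = {y.2} + {q} + (Y.map Prod.snd + D) := by
      rw [Multiset.map_cons, ← Multiset.singleton_add]; abel
    have e3 : {q} + Y.map Prod.snd + ({y.1} + D) = {y.1} + {q} + (Y.map Prod.snd + D) := by abel
    rw [e1, e2]
    rw [e3] at h1
    rcases hY y (Multiset.mem_cons_self _ _) with hy | ⟨hy, hy'⟩
    · rwa [hy]
    · exact h1.tail ⟨p, q, p', Y.map Prod.snd + D, h, by rw [hy], by rw [hy']⟩

theorem IsHistory.reach {N : IONet} {T : ℕ} {X : Multiset (ℕ → N.State)} (h : N.IsHistory T X) :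
    Relation.ReflTransGen N.Step (X.map (· 0)) (X.map (· T)) := by
  induction T with
  | zero => exact .refl
  | succ T ih =>
    refine (ih fun i hi => h i (hi.trans T.lt_succ_self)).trans ?_
    obtain ⟨p, q, p', hδ, hmove, τ, hτ, hτq, hτq'⟩ := h T T.lt_succ_self
    obtain ⟨Y, rfl⟩ := Multiset.exists_cons_of_mem hτ
    have := reach_of_common_move N hδ (Y.map fun σ => (σ T, σ (T + 1))) (by
      intro y hy
      obtain ⟨σ, hσ, rfl⟩ := Multiset.mem_map.1 hy
      exact hmove σ (Multiset.mem_cons_of_mem hσ)) 0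
    simpa [Multiset.map_map, Function.comp_def, hτq, hτq'] using this

/-- Every run has a history. -/
theorem exists_isHistory {N : IONet} {C C' : Multiset N.State}
    (h : Relation.ReflTransGen N.Step C C') :
    ∃ T X, N.IsHistory T X ∧ X.map (· 0) = C ∧ X.map (· T) = C' := by
  classical
  induction h with
  | refl => exact ⟨0, C.map fun x _ => x, fun i hi => absurd hi (by omega), by simp, by simp⟩
  | tail _ hstep ih =>
    obtain ⟨T, X, hX, h0, hT⟩ := ih
    obtain ⟨p, q, p', D, hδ, rfl, rfl⟩ := hstep
    -- The moving process, the observed process and the remaining ones.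
    rw [add_assoc, Multiset.singleton_add, Multiset.singleton_add] at hT
    obtain ⟨μ, hμ, hμp, hT⟩ := (Multiset.map_eq_cons _ _ _ _).2 hT
    obtain ⟨ω, hω, hωq, hT⟩ := (Multiset.map_eq_cons _ _ _ _).2 hT
    obtain ⟨X', rfl⟩ := Multiset.exists_cons_of_mem hμ
    rw [Multiset.erase_cons_head] at hω hT
    obtain ⟨Y, rfl⟩ := Multiset.exists_cons_of_mem hω
    rw [Multiset.erase_cons_head] at hT
    let ext (x : N.State) (τ : ℕ → N.State) : ℕ → N.State := fun i => if i ≤ T then τ i else x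
    have hext : ∀ x τ i, i ≤ T → ext x τ i = τ i := fun x τ i hi => if_pos hi
    have hext' : ∀ x τ, ext x τ (T + 1) = x := fun x τ => if_neg (by omega)
    refine ⟨T + 1, ext p' μ ::ₘ ext q ω ::ₘ Y.map fun τ => ext (τ T) τ, ?_, ?_, ?_⟩
    · intro i hi
      rcases Nat.lt_succ_iff_lt_or_eq.1 hi with hi | rfl
      · obtain ⟨a, b, a', hδ', hmove, τ, hτ, hτq, hτq'⟩ := hX i hi
        refine ⟨a, b, a', hδ', ?_, ?_⟩
        · intro σ hσ
          simp only [Multiset.mem_cons, Multiset.mem_map] at hσ hmove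
          rcases hσ with rfl | rfl | ⟨σ, hσ, rfl⟩ <;>
            rw [hext _ _ _ hi.le, hext _ _ _ hi] <;> apply hmove <;> tauto
        · simp only [Multiset.mem_cons] at hτ
          rcases hτ with rfl | rfl | hτ
          · exact ⟨ext p' τ, by simp, by rw [hext _ _ _ hi.le, hτq], by rw [hext _ _ _ hi, hτq']⟩
          · exact ⟨ext q τ, by simp, by rw [hext _ _ _ hi.le, hτq], by rw [hext _ _ _ hi, hτq']⟩
          · exact ⟨ext (τ T) τ, by
              simp only [Multiset.mem_cons, Multiset.mem_map]; exact Or.inr (Or.inr ⟨τ, hτ, rfl⟩),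
              by rw [hext _ _ _ hi.le, hτq], by rw [hext _ _ _ hi, hτq']⟩
      · refine ⟨p, q, p', hδ, ?_, ext q ω, by simp, by rw [hext _ _ _ le_rfl, hωq], hext' _ _⟩
        intro σ hσ
        simp only [Multiset.mem_cons, Multiset.mem_map] at hσ
        rcases hσ with rfl | rfl | ⟨σ, hσ, rfl⟩ <;> rw [hext', hext _ _ _ le_rfl]
        · exact Or.inr ⟨hμp, rfl⟩
        · exact Or.inl hωq.symm
        · exact Or.inl rfl
    · rw [← h0]
      simp [hext, Multiset.map_map]
    · simp only [Multiset.map_cons, hext', Multiset.map_map, Function.comp_def]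
      rw [← hT, ← Multiset.singleton_add, ← Multiset.singleton_add, add_assoc]

/-- `X'` imitates `X` up to time `T`: processes of `X'` move only where processes of `X` do, and
wherever a process of `X` waits, one of `X'` does. -/
def Imitates {Q : Type} (T : ℕ) (X' X : Multiset (ℕ → Q)) : Prop :=
  ∀ i < T, (∀ τ' ∈ X', τ' (i + 1) = τ' i ∨ ∃ τ ∈ X, τ i = τ' i ∧ τ (i + 1) = τ' (i + 1)) ∧
    ∀ τ ∈ X, τ (i + 1) = τ i → ∃ τ' ∈ X', τ' i = τ i ∧ τ' (i + 1) = τ i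

theorem Imitates.isHistory {N : IONet} {T : ℕ} {X' X : Multiset (ℕ → N.State)}
    (h : Imitates T X' X) (hX : N.IsHistory T X) : N.IsHistory T X' := by
  intro i hi
  obtain ⟨p, q, p', hδ, hmove, τ, hτ, hτq, hτq'⟩ := hX i hi
  obtain ⟨h1, h2⟩ := h i hi
  refine ⟨p, q, p', hδ, fun σ hσ => ?_, ?_⟩
  · rcases h1 σ hσ with h | ⟨ρ, hρ, e1, e2⟩
    · exact Or.inl h
    · rw [← e1, ← e2]
      exact hmove ρ hρ
  · obtain ⟨σ, hσ, e1, e2⟩ := h2 τ hτ (hτq'.trans hτq.symm)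
    exact ⟨σ, hσ, e1.trans hτq, e2.trans hτq⟩

theorem Imitates.refl {Q : Type} (T : ℕ) (X : Multiset (ℕ → Q)) : Imitates T X X :=
  fun _ _ => ⟨fun τ hτ => Or.inr ⟨τ, hτ, rfl, rfl⟩, fun τ hτ h => ⟨τ, hτ, rfl, h⟩⟩

theorem Imitates.sum {Q ι : Type} {T : ℕ} (s : Finset ι) {X' X : ι → Multiset (ℕ → Q)}
    (h : ∀ x ∈ s, Imitates T (X' x) (X x)) : Imitates T (∑ x ∈ s, X' x) (∑ x ∈ s, X x) := by
  intro i hi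
  simp only [Multiset.mem_sum]
  refine ⟨?_, ?_⟩
  · rintro τ ⟨x, hx, hτ⟩
    rcases (h x hx i hi).1 τ hτ with h' | ⟨σ, hσ, h'⟩
    · exact Or.inl h'
    · exact Or.inr ⟨σ, ⟨x, hx, hσ⟩, h'⟩
  · rintro τ ⟨x, hx, hτ⟩ hw
    obtain ⟨σ, hσ, h'⟩ := (h x hx i hi).2 τ hτ hw
    exact ⟨σ, ⟨x, hx, hσ⟩, h'⟩

/-- For a state `x` visited by a bunch `B` of trajectories, there is a trajectory that moves like
processes of `B` and is at `x` from the first to the last visit of `B` to `x`. -/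
theorem exists_waiting_trajectory {Q : Type} {T : ℕ} {B : Multiset (ℕ → Q)} {s e x : Q}
    (hB : ∀ τ ∈ B, τ 0 = s ∧ τ T = e) (hx : ∃ τ ∈ B, ∃ i ≤ T, τ i = x) :
    ∃ σ : ℕ → Q, σ 0 = s ∧ σ T = e ∧
      (∀ i < T, σ (i + 1) = σ i ∨ ∃ τ ∈ B, τ i = σ i ∧ τ (i + 1) = σ (i + 1)) ∧
      ∀ τ ∈ B, ∀ i < T, τ i = x → τ (i + 1) = x → σ i = x ∧ σ (i + 1) = x := by
  classical
  let V : Finset ℕ := (Finset.range (T + 1)).filter fun i => ∃ τ ∈ B, τ i = x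
  have hV : ∀ i, i ∈ V ↔ i ≤ T ∧ ∃ τ ∈ B, τ i = x := by
    intro i; simp [V]
  have hne : V.Nonempty := by
    obtain ⟨τ, hτ, i, hi, h⟩ := hx
    exact ⟨i, (hV i).2 ⟨hi, τ, hτ, h⟩⟩
  obtain ⟨hfT, α, hα, hαx⟩ := (hV _).1 (V.min'_mem hne)
  obtain ⟨hlT, β, hβ, hβx⟩ := (hV _).1 (V.max'_mem hne)
  have hfirst : ∀ i ∈ V, V.min' hne ≤ i := fun i hi => V.min'_le i hi
  have hlast : ∀ i ∈ V, i ≤ V.max' hne := fun i hi => V.le_max' i hi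
  have hfl := hfirst _ (V.max'_mem hne)
  generalize V.min' hne = f at *
  generalize V.max' hne = l at *
  let σ : ℕ → Q := fun i => if i ≤ f then α i else if i ≤ l then x else β i
  have h1 : ∀ i ≤ f, σ i = α i := fun i hi => if_pos hi
  have h2 : ∀ i, f ≤ i → i ≤ l → σ i = x := by
    intro i hi hi'
    rcases hi.eq_or_lt with rfl | hi
    · rw [h1 _ le_rfl, hαx]
    · simp only [σ]; rw [if_neg (by omega), if_pos hi']
  have h3 : ∀ i, l ≤ i → σ i = β i := by
    intro i hi
    rcases hi.eq_or_lt with rfl | hi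
    · rw [h2 _ hfl le_rfl, hβx]
    · simp only [σ]; rw [if_neg (by omega), if_neg (by omega)]
  refine ⟨σ, by rw [h1 0 (Nat.zero_le _), (hB α hα).1], by rw [h3 T hlT, (hB β hβ).2], ?_, ?_⟩
  · intro i hi
    rcases lt_or_ge i f with hif | hif
    · exact Or.inr ⟨α, hα, (h1 _ hif.le).symm, (h1 _ hif).symm⟩
    · rcases lt_or_ge i l with hil | hil
      · exact Or.inl (by rw [h2 i hif hil.le, h2 (i + 1) (by omega) hil])
      · exact Or.inr ⟨β, hβ, (h3 _ hil).symm, (h3 _ (by omega)).symm⟩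
  · intro τ hτ i hi hi1 hi2
    have a1 := hfirst i ((hV i).2 ⟨hi.le, τ, hτ, hi1⟩)
    have a2 := hlast (i + 1) ((hV (i + 1)).2 ⟨hi, τ, hτ, hi2⟩)
    exact ⟨h2 i a1 (by omega), h2 (i + 1) (by omega) a2⟩

/-- A nonempty bunch of trajectories with common ends is imitated by a bunch of any size `m` that
is at least the number of states: one waiting trajectory for each state, and copies of an
arbitrary trajectory. -/
theorem exists_imitating_bunch {Q : Type} [Fintype Q] {T m : ℕ} {B : Multiset (ℕ → Q)} {s e : Q}
    (hB : ∀ τ ∈ B, τ 0 = s ∧ τ T = e) (hne : B ≠ 0) (hm : Fintype.card Q ≤ m) :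
    ∃ B', B'.card = m ∧ (∀ τ ∈ B', τ 0 = s ∧ τ T = e) ∧ Imitates T B' B := by
  classical
  obtain ⟨γ, hγ⟩ := Multiset.exists_mem_of_ne_zero hne
  have key : ∀ x : Q, ∃ σ : ℕ → Q, σ 0 = s ∧ σ T = e ∧
      (∀ i < T, σ (i + 1) = σ i ∨ ∃ τ ∈ B, τ i = σ i ∧ τ (i + 1) = σ (i + 1)) ∧
      ∀ τ ∈ B, ∀ i < T, τ i = x → τ (i + 1) = x → σ i = x ∧ σ (i + 1) = x := by
    intro x
    by_cases hx : ∃ τ ∈ B, ∃ i ≤ T, τ i = x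
    · exact exists_waiting_trajectory hB hx
    · exact ⟨γ, (hB γ hγ).1, (hB γ hγ).2, fun i _ => Or.inr ⟨γ, hγ, rfl, rfl⟩,
        fun τ hτ i hi h _ => absurd ⟨τ, hτ, i, hi.le, h⟩ hx⟩
  choose σ h0 hT hmove hwait using key
  have hmem : ∀ τ ∈ Finset.univ.val.map σ + Multiset.replicate (m - Fintype.card Q) γ,
      (∃ x, σ x = τ) ∨ τ = γ := by
    intro τ hτ
    rcases Multiset.mem_add.1 hτ with h | h
    · obtain ⟨x, -, hx⟩ := Multiset.mem_map.1 h
      exact Or.inl ⟨x, hx⟩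
    · exact Or.inr (Multiset.eq_of_mem_replicate h)
  refine ⟨Finset.univ.val.map σ + Multiset.replicate (m - Fintype.card Q) γ, ?_, ?_, ?_⟩
  · rw [Multiset.card_add, Multiset.card_map, Multiset.card_replicate, Finset.card_val,
      Finset.card_univ]
    omega
  · intro τ hτ
    rcases hmem τ hτ with ⟨x, rfl⟩ | rfl
    · exact ⟨h0 x, hT x⟩
    · exact hB τ hγ
  · intro i hi
    refine ⟨fun τ hτ => ?_, fun τ hτ hw => ?_⟩
    · rcases hmem τ hτ with ⟨x, rfl⟩ | rfl
      · exact hmove x i hi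
      · exact Or.inr ⟨τ, hγ, rfl, rfl⟩
    · exact ⟨σ (τ i), Multiset.mem_add.2 (Or.inl (Multiset.mem_map_of_mem σ (Finset.mem_univ _))),
        hwait (τ i) τ hτ i hi rfl hw⟩

theorem _root_.Multiset.sum_filter_eq {α β : Type} [Fintype β] [DecidableEq β] (X : Multiset α)
    (g : α → β) : ∑ b, X.filter (fun a => g a = b) = X := by
  induction X using Multiset.induction_on with
  | empty => simp
  | cons a X ih =>
    conv_rhs => rw [← ih]
    simp only [Multiset.filter_cons, Finset.sum_add_distrib]
    rw [Finset.sum_ite_eq, if_pos (Finset.mem_univ _), Multiset.singleton_add]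

theorem _root_.Multiset.map_eq_nsmul_singleton {α β : Type} {X : Multiset α} {g : α → β} {b : β}
    (h : ∀ a ∈ X, g a = b) : X.map g = X.card • {b} := by
  rw [Multiset.nsmul_singleton, Multiset.eq_replicate]
  simpa using h

/-- A run from `C` to `C'` has a flow `F`, where `F (s, e)` processes go from `s` to `e`. Entries
of the flow that are at least the number of states may be changed to any other such numbers. -/
theorem exists_flow {N : IONet} {C C' : Multiset N.State}
    (h : Relation.ReflTransGen N.Step C C') :
    ∃ F : N.State × N.State → ℕ, C = ∑ x, F x • {x.1} ∧ C' = ∑ x, F x • {x.2} ∧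
      ∀ G : N.State × N.State → ℕ,
        (∀ x, G x = F x ∨ Fintype.card N.State ≤ F x ∧ Fintype.card N.State ≤ G x) →
        Relation.ReflTransGen N.Step (∑ x, G x • {x.1}) (∑ x, G x • {x.2}) := by
  classical
  obtain ⟨T, X, hX, rfl, rfl⟩ := exists_isHistory h
  let B (x : N.State × N.State) : Multiset (ℕ → N.State) := X.filter fun τ => (τ 0, τ T) = x
  have hB : ∀ x, ∀ τ ∈ B x, τ 0 = x.1 ∧ τ T = x.2 := by
    rintro x τ hτ
    rw [← (Multiset.mem_filter.1 hτ).2]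
    exact ⟨rfl, rfl⟩
  have hsum : ∑ x, B x = X := Multiset.sum_filter_eq X _
  have hmap : ∀ (Y : N.State × N.State → Multiset (ℕ → N.State)) (i : ℕ)
      (v : N.State × N.State → N.State), (∀ x, ∀ τ ∈ Y x, τ i = v x) →
      (∑ x, Y x).map (· i) = ∑ x, (Y x).card • {v x} := by
    intro Y i v hY
    rw [← Multiset.coe_mapAddMonoidHom, map_sum]
    exact Finset.sum_congr rfl fun x _ => Multiset.map_eq_nsmul_singleton (hY x)
  refine ⟨fun x => (B x).card, ?_, ?_, fun G hG => ?_⟩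
  · rw [← hmap B 0 _ fun x τ hτ => (hB x τ hτ).1, hsum]
  · rw [← hmap B T _ fun x τ hτ => (hB x τ hτ).2, hsum]
  · have key : ∀ x, ∃ B', B'.card = G x ∧ (∀ τ ∈ B', τ 0 = x.1 ∧ τ T = x.2) ∧
        Imitates T B' (B x) := by
      intro x
      rcases hG x with h | ⟨h1, h2⟩
      · exact ⟨B x, h.symm, hB x, .refl _ _⟩
      · refine exists_imitating_bunch (hB x) ?_ h2
        have : 0 < Fintype.card N.State := Fintype.card_pos_iff.2 ⟨x.1⟩
        rw [← Multiset.card_pos]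
        exact this.trans_le h1
    choose B' hcard hends him using key
    have himit : Imitates T (∑ x, B' x) X := by
      rw [← hsum]
      exact Imitates.sum _ fun x _ => him x
    have := (himit.isHistory hX).reach
    rw [hmap B' 0 _ fun x τ hτ => (hends x τ hτ).1, hmap B' T _ fun x τ hτ => (hends x τ hτ).2]
      at this
    simpa only [hcard] using this

end IONet

/-! ### Reachability in immediate observation nets preserves counting sets -/

namespace IONet

/-- Cutting down and then freely raising the large flow entries that lead to unbounded states gives
a cube of polynomial norm around every configuration in `pre*` of a cube. -/
theorem exists_cube_subset_preStar (N : IONet) (K : Cube N.State) {C : Multiset N.State}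
    (hC : C ∈ preStar N.Step K.toSet) :
    ∃ K' : Cube N.State,
      K'.norm ≤ K.norm + Fintype.card N.State * K.norm + Fintype.card N.State ^ 3 ∧
      C ∈ K'.toSet ∧ K'.toSet ⊆ preStar N.Step K.toSet := by
  classical
  obtain ⟨C', hC', hreach⟩ := hC
  obtain ⟨F, hFC, hFC', hpump⟩ := exists_flow hreach
  rw [Cube.mem_toSet] at hC'
  generalize hn : Fintype.card N.State = n at *
  have row : ∀ (G : N.State × N.State → ℕ) (s : N.State),
      (∑ x, G x • ({x.1} : Multiset N.State)).count s = ∑ e, G (s, e) := by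
    intro G s
    rw [Multiset.count_sum_nsmul_singleton, Fintype.sum_prod_type_right]
    simp
  have col : ∀ (G : N.State × N.State → ℕ) (e : N.State),
      (∑ x, G x • ({x.2} : Multiset N.State)).count e = ∑ s, G (s, e) := by
    intro G e
    rw [Multiset.count_sum_nsmul_singleton, Fintype.sum_prod_type]
    simp
  have hCs : ∀ s, C.count s = ∑ e, F (s, e) := fun s => by conv_lhs => rw [hFC, row]
  have hCe : ∀ e, C'.count e = ∑ s, F (s, e) := fun e => by conv_lhs => rw [hFC', col]
  -- Entries leading to a bounded state are kept. The others are cut down so that they remain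
  -- pumpable if they were, and that a single cut entry meets the lower bound of its target.
  let G₀ : N.State × N.State → ℕ := fun x =>
    if K.upper x.2 = ⊤ then min (F x) (n + K.lower x.2) else F x
  have hG₀F : ∀ x, G₀ x ≤ F x := by
    intro x; simp only [G₀]; split_ifs; exacts [min_le_left _ _, le_rfl]
  let Pump : N.State → N.State → Prop := fun s e => K.upper e = ⊤ ∧ n + K.lower e ≤ F (s, e)
  have hG₀ : ∀ s e, ¬ Pump s e → G₀ (s, e) = F (s, e) := by
    intro s e h
    simp only [G₀]
    split_ifs with hu
    · exact min_eq_left (le_of_lt (not_le.1 fun h' => h ⟨hu, h'⟩))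
    · rfl
  have hG₀' : ∀ s e, Pump s e → G₀ (s, e) = n + K.lower e := by
    intro s e h
    simp only [G₀]
    rw [if_pos h.1, min_eq_right h.2]
  let K' : Cube N.State :=
    { lower := fun s => ∑ e, G₀ (s, e)
      upper := fun s => if ∃ e, Pump s e then ⊤ else ((∑ e, G₀ (s, e) : ℕ) : ℕ∞) }
  have hlow : K'.lnorm ≤ K.norm + n * K.norm + n ^ 3 := by
    have h1 : ∀ e, ∑ s, G₀ (s, e) ≤ (K.upper e).toNat + n * (n + K.lower e) := by
      intro e
      by_cases hu : K.upper e = ⊤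
      · refine le_add_left ((Finset.sum_le_card_nsmul _ _ (n + K.lower e) fun s _ => ?_).trans ?_)
        · simp only [G₀]; rw [if_pos hu]; exact min_le_right _ _
        · rw [Finset.card_univ, hn, smul_eq_mul]
      · refine le_add_right ((Finset.sum_le_sum fun s _ => hG₀F (s, e)).trans ?_)
        rw [← hCe e]
        have := ENat.toNat_le_toNat (hC' e).2 hu
        simpa using this
    calc K'.lnorm = ∑ e, ∑ s, G₀ (s, e) := Finset.sum_comm
      _ ≤ ∑ e, ((K.upper e).toNat + n * (n + K.lower e)) := Finset.sum_le_sum fun e _ => h1 e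
      _ = K.unorm + n * K.lnorm + n ^ 3 := by
          rw [Finset.sum_add_distrib, ← Finset.mul_sum, Finset.sum_add_distrib, Finset.sum_const,
            Finset.card_univ, hn, smul_eq_mul]
          unfold Cube.unorm Cube.lnorm
          ring
      _ ≤ K.norm + n * K.norm + n ^ 3 := by
          gcongr
          · exact le_max_right _ _
          · exact le_max_left _ _
  have hup : K'.unorm ≤ K'.lnorm := by
    refine Finset.sum_le_sum fun s _ => ?_
    simp only [K']
    split_ifs
    · simp
    · exact (ENat.toNat_natCast _).le
  refine ⟨K', max_le hlow (hup.trans hlow), Cube.mem_toSet.2 fun s => ?_, fun D hD => ?_⟩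
  · rw [hCs s]
    refine ⟨Finset.sum_le_sum fun e _ => hG₀F (s, e), ?_⟩
    simp only [K']
    split_ifs with h
    · exact le_top
    · push Not at h
      exact_mod_cast Finset.sum_le_sum fun e _ => (hG₀ s e (h e)).ge
  · rw [Cube.mem_toSet] at hD
    -- The surplus of `D` over the lower bound is sent along pumpable entries.
    have hR : ∀ s, ∃ R : N.State → ℕ, D.count s = ∑ e, (G₀ (s, e) + R e) ∧
        ∀ e, R e ≠ 0 → Pump s e := by
      intro s
      by_cases h : ∃ e, Pump s e
      · obtain ⟨e, he⟩ := h
        refine ⟨fun e' => if e' = e then D.count s - ∑ e, G₀ (s, e) else 0, ?_, ?_⟩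
        · rw [Finset.sum_add_distrib, Finset.sum_ite_eq' Finset.univ e, if_pos (Finset.mem_univ e)]
          exact (Nat.add_sub_cancel' (hD s).1).symm
        · intro e' he'
          by_cases h' : e' = e
          · rwa [h']
          · exact absurd (if_neg h') he'
      · refine ⟨fun _ => 0, ?_, fun _ h' => absurd rfl h'⟩
        have h1 := (hD s).1
        have h2 := (hD s).2
        simp only [K', if_neg h, Nat.cast_le] at h1 h2
        simpa using le_antisymm h2 h1
    choose R hRsum hRpump using hR
    let G : N.State × N.State → ℕ := fun x => G₀ x + R x.1 x.2
    have hGF : ∀ s e, ¬ Pump s e → G (s, e) = F (s, e) := by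
      intro s e h
      have : R s e = 0 := by_contra fun h' => h (hRpump s e h')
      simp only [G, this, hG₀ s e h, add_zero]
    have hGF' : ∀ s e, Pump s e → n + K.lower e ≤ G (s, e) := by
      intro s e h
      rw [← hG₀' s e h]
      exact Nat.le_add_right _ _
    have hDG : D = ∑ x, G x • {x.1} := by
      ext s
      rw [row, hRsum]
    refine ⟨∑ x, G x • {x.2}, Cube.mem_toSet.2 fun e => ?_, ?_⟩
    · rw [col]
      by_cases h : ∃ s, Pump s e
      · obtain ⟨s, hs⟩ := h
        refine ⟨?_, by rw [hs.1]; exact le_top⟩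
        exact (le_add_left le_rfl).trans ((hGF' s e hs).trans
          (Finset.single_le_sum (f := fun s => G (s, e)) (fun _ _ => Nat.zero_le _)
            (Finset.mem_univ s)))
      · push Not at h
        rw [Finset.sum_congr rfl fun s _ => hGF s e (h s), ← hCe e]
        exact hC' e
    · rw [hDG]
      refine hpump G fun ⟨s, e⟩ => ?_
      by_cases h : Pump s e
      · exact Or.inr ⟨(Nat.le_add_right _ _).trans h.2, (Nat.le_add_right _ _).trans (hGF' s e h)⟩
      · exact Or.inl (hGF s e h)

theorem isCountingSetOfNormLE_preStar (N : IONet) {S : Set (Multiset N.State)} {m : ℕ}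
    (hS : IsCountingSetOfNormLE S m) :
    IsCountingSetOfNormLE (preStar N.Step S)
      (m + Fintype.card N.State * m + Fintype.card N.State ^ 3) := by
  rw [isCountingSetOfNormLE_iff] at hS ⊢
  rintro C ⟨C', hC', hreach⟩
  obtain ⟨K, hK, hCK, hKS⟩ := hS C' hC'
  obtain ⟨K', hK', hCK', hsub⟩ := exists_cube_subset_preStar N K ⟨C', hCK, hreach⟩
  refine ⟨K', hK'.trans (by gcongr), hCK', fun D hD => ?_⟩
  obtain ⟨D', hD', h⟩ := hsub hD
  exact ⟨D', hKS hD', h⟩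

/-- The net with all transitions reversed, which is again an immediate observation net. -/
def reverse (N : IONet) : IONet where
  State := N.State
  δ := {t | (t.2.2, t.2.1, t.1) ∈ N.δ}

theorem reach_reverse (N : IONet) {C C' : Multiset N.State} :
    Relation.ReflTransGen N.reverse.Step C C' ↔ Relation.ReflTransGen N.Step C' C := by
  rw [← Relation.reflTransGen_swap]
  have : Function.swap N.reverse.Step = N.Step := by
    funext C C'
    refine propext ⟨?_, ?_⟩
    · rintro ⟨p, q, p', D, h, e, e'⟩
      exact ⟨p', q, p, D, h, e', e⟩
    · rintro ⟨p, q, p', D, h, e, e'⟩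
      exact ⟨p', q, p, D, h, e', e⟩
  exact this ▸ Iff.rfl

theorem isCountingSetOfNormLE_postStar (N : IONet) {S : Set (Multiset N.State)} {m : ℕ}
    (hS : IsCountingSetOfNormLE S m) :
    IsCountingSetOfNormLE (postStar N.Step S)
      (m + Fintype.card N.State * m + Fintype.card N.State ^ 3) := by
  have : postStar N.Step S = preStar N.reverse.Step S := by
    ext C
    exact exists_congr fun C' => and_congr_right fun _ => N.reach_reverse.symm
  rw [this]
  exact N.reverse.isCountingSetOfNormLE_preStar hS

end IONet

/-! ### Transfer along strong simulations -/

theorem Finset.sum_comp_embedding_le {P Q : Type} [Fintype P] [Fintype Q] (f : P ↪ Q) (g : Q → ℕ) :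
    ∑ p, g (f p) ≤ ∑ q, g q := by
  rw [← Finset.sum_map Finset.univ f g]
  exact Finset.sum_le_sum_of_subset (Finset.subset_univ _)

theorem Finset.sum_extend_le {P Q A : Type} [Fintype P] [Fintype Q] (f : P ↪ Q) (φ : A → ℕ)
    (g : P → A) (g' : Q → A) :
    ∑ q, φ (Function.extend f g g' q) ≤ ∑ p, φ (g p) + ∑ q, φ (g' q) := by
  classical
  calc ∑ q, φ (Function.extend f g g' q)
      ≤ ∑ q, (Function.extend f (φ ∘ g) 0 q + φ (g' q)) := by
        refine Finset.sum_le_sum fun q _ => ?_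
        by_cases h : ∃ p, f p = q
        · obtain ⟨p, rfl⟩ := h
          simp [f.injective.extend_apply]
        · simp [Function.extend_apply' _ _ _ h]
    _ = ∑ p, φ (g p) + ∑ q, φ (g' q) := by
        rw [Finset.sum_add_distrib]
        congr 1
        rw [← Finset.sum_subset (Finset.subset_univ (Finset.univ.map f)) fun q _ hq => ?_,
          Finset.sum_map]
        · simp [f.injective.extend_apply]
        · exact Function.extend_apply' _ _ _ fun ⟨p, hp⟩ => hq (by simp [← hp])

section Extension

variable {P Q : Type} {f : P ↪ Q} {h : Multiset Q}

theorem Multiset.count_extension_apply [DecidableEq P] [DecidableEq Q] (hf : ∀ p, f p ∉ h)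
    (C : Multiset P) (p : P) :
    (C.map f + h).count (f p) = C.count p := by
  rw [Multiset.count_add, Multiset.count_map_eq_count' _ _ f.injective,
    Multiset.count_eq_zero_of_notMem (hf p), add_zero]

theorem Multiset.count_extension_of_notMem [DecidableEq Q] (C : Multiset P) {q : Q}
    (hq : ¬ ∃ p, f p = q) : (C.map f + h).count q = h.count q := by
  rw [Multiset.count_add, Multiset.count_eq_zero_of_notMem, zero_add]
  exact fun hq' => hq ((Multiset.mem_map.1 hq').imp fun _ h => h.2)

/-- If `S` is a counting set, then so is `S · h = {C · h | C ∈ S}`. -/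
theorem IsCountingSetOfNormLE.extension [Fintype P] [Fintype Q] (hf : ∀ p, f p ∉ h)
    {S : Set (Multiset P)} {m : ℕ} (hS : IsCountingSetOfNormLE S m) :
    IsCountingSetOfNormLE ((fun C => C.map f + h) '' S) (m + h.card) := by
  classical
  rw [isCountingSetOfNormLE_iff] at hS ⊢
  rintro _ ⟨C, hC, rfl⟩
  obtain ⟨K, hK, hCK, hKS⟩ := hS C hC
  have hcard : ∑ q, h.count q = h.card := Multiset.sum_count_eq_card fun _ _ => Finset.mem_univ _
  refine ⟨⟨Function.extend f K.lower fun q => h.count q,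
    Function.extend f K.upper fun q => (h.count q : ℕ∞)⟩, max_le ?_ ?_, ?_, ?_⟩
  · refine (Finset.sum_extend_le f id K.lower _).trans ?_
    simp only [id, hcard]
    gcongr
    exact (le_max_left _ _).trans hK
  · refine (Finset.sum_extend_le f ENat.toNat K.upper _).trans ?_
    simp only [ENat.toNat_natCast, hcard]
    gcongr
    exact (le_max_right _ _).trans hK
  · rw [Cube.mem_toSet] at hCK ⊢
    intro q
    by_cases hq : ∃ p, f p = q
    · obtain ⟨p, rfl⟩ := hq
      simpa only [f.injective.extend_apply, Multiset.count_extension_apply hf] using hCK p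
    · simp [Function.extend_apply' _ _ _ hq, Multiset.count_extension_of_notMem C hq]
  · intro X hX
    rw [Cube.mem_toSet] at hX
    have hcount : ∀ p, (∑ p, X.count (f p) • ({p} : Multiset P)).count p = X.count (f p) := by
      intro p
      rw [Multiset.count_sum_nsmul_singleton]
      simp
    refine ⟨∑ p, X.count (f p) • {p}, hKS (Cube.mem_toSet.2 fun p => ?_), ?_⟩
    · rw [hcount]
      simpa only [f.injective.extend_apply] using hX (f p)
    · ext q
      by_cases hq : ∃ p, f p = q
      · obtain ⟨p, rfl⟩ := hq
        rw [Multiset.count_extension_apply hf, hcount]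
      · rw [Multiset.count_extension_of_notMem _ hq]
        have := hX q
        simp only [Function.extend_apply' _ _ _ hq, Nat.cast_le] at this
        exact le_antisymm this.1 this.2

/-- If `S'` is a counting set, then so is `{C | C · h ∈ S'}`. -/
theorem IsCountingSetOfNormLE.slice [Fintype P] [Fintype Q] (hf : ∀ p, f p ∉ h)
    {S' : Set (Multiset Q)} {m : ℕ} (hS : IsCountingSetOfNormLE S' m) :
    IsCountingSetOfNormLE {C | C.map f + h ∈ S'} m := by
  classical
  rw [isCountingSetOfNormLE_iff] at hS ⊢
  intro C hC
  obtain ⟨K, hK, hCK, hKS⟩ := hS _ hC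
  rw [Cube.mem_toSet] at hCK
  refine ⟨⟨K.lower ∘ f, K.upper ∘ f⟩, max_le ?_ ?_, ?_, ?_⟩
  · exact (Finset.sum_comp_embedding_le f K.lower).trans ((le_max_left _ _).trans hK)
  · exact (Finset.sum_comp_embedding_le f fun q => (K.upper q).toNat).trans
      ((le_max_right _ _).trans hK)
  · refine Cube.mem_toSet.2 fun p => ?_
    simpa only [Multiset.count_extension_apply hf, Function.comp_apply] using hCK (f p)
  · intro D hD
    rw [Cube.mem_toSet] at hD
    refine hKS (Cube.mem_toSet.2 fun q => ?_)
    by_cases hq : ∃ p, f p = q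
    · obtain ⟨p, rfl⟩ := hq
      simpa only [Multiset.count_extension_apply hf, Function.comp_apply] using hD p
    · have := hCK q
      rwa [Multiset.count_extension_of_notMem _ hq] at this ⊢

end Extension

namespace IsStrongSimulation

variable {I J : ProcessSystem} {f : I.Place ↪ J.Place} {h : Multiset J.Place}

theorem mem_postStar_iff (hs : IsStrongSimulation I J f h) {S : Set (Multiset I.Place)}
    (hS : ∀ C ∈ S, I.IsConfig C) {C : Multiset I.Place} (hC : I.IsConfig C) :
    C ∈ postStar I.Step S ↔ C.map f + h ∈ postStar J.Step ((fun C => C.map f + h) '' S) := by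
  have key := fun C₀ (hC₀ : I.IsConfig C₀) => hs.2.2 C₀ C hC₀ hC
  constructor
  · rintro ⟨C₀, hC₀, hr⟩
    obtain ⟨_, rfl, hr'⟩ := (key C₀ (hS C₀ hC₀)).1 ⟨C₀, rfl, hr⟩
    exact ⟨_, ⟨C₀, hC₀, rfl⟩, hr'⟩
  · rintro ⟨_, ⟨C₀, hC₀, rfl⟩, hr⟩
    obtain ⟨_, rfl, hr'⟩ := (key C₀ (hS C₀ hC₀)).2 ⟨_, rfl, hr⟩
    exact ⟨_, hC₀, hr'⟩

theorem mem_preStar_iff (hs : IsStrongSimulation I J f h) {S : Set (Multiset I.Place)}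
    (hS : ∀ C ∈ S, I.IsConfig C) {C : Multiset I.Place} (hC : I.IsConfig C) :
    C ∈ preStar I.Step S ↔ C.map f + h ∈ preStar J.Step ((fun C => C.map f + h) '' S) := by
  have key := fun C₀ (hC₀ : I.IsConfig C₀) => hs.2.2 C C₀ hC hC₀
  constructor
  · rintro ⟨C₀, hC₀, hr⟩
    obtain ⟨_, rfl, hr'⟩ := (key C₀ (hS C₀ hC₀)).1 ⟨C, rfl, hr⟩
    exact ⟨_, ⟨C₀, hC₀, rfl⟩, hr'⟩
  · rintro ⟨_, ⟨C₀, hC₀, rfl⟩, hr⟩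
    obtain ⟨_, rfl, hr'⟩ := (key C₀ (hS C₀ hC₀)).2 ⟨_, rfl, hr⟩
    exact ⟨_, hC₀, hr'⟩

end IsStrongSimulation

theorem transfer_bound_le (a n : ℕ) : a + n * a + n ^ 3 ≤ 3 * (a + n) ^ 3 := by
  rcases Nat.eq_zero_or_pos (a + n) with h | h
  · obtain ⟨rfl, rfl⟩ := Nat.add_eq_zero_iff.1 h
    simp
  · have h1 : a ≤ (a + n) ^ 3 := (Nat.le_add_right a n).trans (Nat.le_self_pow (by omega) _)
    have h2 : n * a ≤ (a + n) ^ 3 := by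
      calc n * a ≤ (a + n) * (a + n) := Nat.mul_le_mul (by omega) (by omega)
        _ = (a + n) ^ 2 := (sq _).symm
        _ ≤ (a + n) ^ 3 := Nat.pow_le_pow_right h (by omega)
    have h3 : n ^ 3 ≤ (a + n) ^ 3 := Nat.pow_le_pow_left (by omega) 3
    omega

/-- If an immediate observation net strongly simulates a system, then `post*` and `pre*` of a
counting set of configurations agree, on configurations, with counting sets of small norm. -/
theorem IsStrongSimulation.exists_isCountingSetOfNormLE {I : ProcessSystem} [Fintype I.Place]
    {N : IONet} {f : I.Place ↪ N.toSystem.Place} {h : Multiset N.toSystem.Place}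
    (hs : IsStrongSimulation I N.toSystem f h) {S : Set (Multiset I.Place)}
    (hS : ∀ C ∈ S, I.IsConfig C) {m : ℕ} (hm : IsCountingSetOfNormLE S m) :
    (∃ S', IsCountingSetOfNormLE S' (3 * (m + h.card + Fintype.card N.State) ^ 3) ∧
      ∀ C, I.IsConfig C → (C ∈ postStar I.Step S ↔ C ∈ S')) ∧
    ∃ S', IsCountingSetOfNormLE S' (3 * (m + h.card + Fintype.card N.State) ^ 3) ∧
      ∀ C, I.IsConfig C → (C ∈ preStar I.Step S ↔ C ∈ S') := by
  let : Fintype N.toSystem.Place := N.fintypeState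
  have hext := hm.extension hs.1
  exact ⟨⟨_, ((N.isCountingSetOfNormLE_postStar hext).mono (transfer_bound_le _ _)).slice hs.1,
      fun C hC => hs.mem_postStar_iff hS hC⟩,
    ⟨_, ((N.isCountingSetOfNormLE_preStar hext).mono (transfer_bound_le _ _)).slice hs.1,
      fun C hC => hs.mem_preStar_iff hS hC⟩⟩

theorem RBN.isCountingSetOfNormLE_of_isStrongSimulation {R : RBN} {N : IONet}
    {f : R.toSystem.Place ↪ N.toSystem.Place} {h : Multiset N.toSystem.Place}
    (hs : IsStrongSimulation R.toSystem N.toSystem f h) {S : Set (Multiset R.State)}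
    (hS : IsCountingSet S) :
    IsCountingSetOfNormLE (postStar R.Step S)
      (3 * (countingNorm S + h.card + Fintype.card N.State) ^ 3) ∧
    IsCountingSetOfNormLE (preStar R.Step S)
      (3 * (countingNorm S + h.card + Fintype.card N.State) ^ 3) := by
  let : Fintype R.toSystem.Place := R.fintypeState
  obtain ⟨⟨S₁, h₁, e₁⟩, S₂, h₂, e₂⟩ :=
    hs.exists_isCountingSetOfNormLE (S := S) (fun _ _ => trivial) hS.normLE
  have e₁' : postStar R.Step S = S₁ := Set.ext fun C => e₁ C trivial
  have e₂' : preStar R.Step S = S₂ := Set.ext fun C => e₂ C trivial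
  rw [e₁', e₂']
  exact ⟨h₁, h₂⟩

/-! ### The counter as a reconfigurable broadcast network -/

/-- The indices of the levels below `i`. -/
def levelsBelow (n i : ℕ) : Multiset (Fin n) :=
  (Finset.univ.filter fun j : Fin n => j.val < i).val

theorem levelsBelow_zero (n : ℕ) : levelsBelow n 0 = 0 := by simp [levelsBelow]

theorem levelsBelow_succ {n i : ℕ} (hi : i < n) :
    levelsBelow n (i + 1) = ⟨i, hi⟩ ::ₘ levelsBelow n i := by
  have hmem : (⟨i, hi⟩ : Fin n) ∉ Finset.univ.filter fun j : Fin n => j.val < i := by simp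
  have : (Finset.univ.filter fun j : Fin n => j.val < i + 1) =
      Finset.cons ⟨i, hi⟩ (Finset.univ.filter fun j : Fin n => j.val < i) hmem := by
    ext j
    simp only [Finset.mem_filter, Finset.mem_univ, true_and, Finset.mem_cons, Fin.ext_iff]
    omega
  unfold levelsBelow
  rw [this, Finset.cons_val]

theorem count_map_levelsBelow_self {n : ℕ} {Q : Type} [DecidableEq Q] {g : Fin n → Q}
    (hg : Function.Injective g) (i : Fin n) : ((levelsBelow n n).map g).count (g i) = 1 :=
  Multiset.count_eq_one_of_mem ((Multiset.nodup_map_iff_of_injective hg).2 (Finset.nodup _))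
    (Multiset.mem_map_of_mem g (by simp [levelsBelow]))

theorem count_map_levelsBelow_of_ne {n i : ℕ} {Q : Type} [DecidableEq Q] {g : Fin n → Q} {x : Q}
    (hx : ∀ j, g j ≠ x) : ((levelsBelow n i).map g).count x = 0 := by
  rw [Multiset.count_eq_zero]
  intro h
  obtain ⟨j, -, hj⟩ := Multiset.mem_map.1 h
  exact hx j hj

/-- A set described by cubes with lower bounds below the number of occurrences of `q` in one of its
elements is closed under removing one such occurrence. -/
theorem IsCountingSetOfNormLE.erase_mem {Q : Type} [Fintype Q] [DecidableEq Q]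
    {S : Set (Multiset Q)} {m : ℕ} (hS : IsCountingSetOfNormLE S m) {C : Multiset Q} (hC : C ∈ S)
    {q : Q} (hq : m < C.count q) : C.erase q ∈ S := by
  obtain ⟨K, hK, hCK, hKS⟩ := isCountingSetOfNormLE_iff.1 hS C hC
  rw [Cube.mem_toSet] at hCK
  refine hKS (Cube.mem_toSet.2 fun r => ?_)
  by_cases hr : r = q
  · subst hr
    rw [Multiset.count_erase_self]
    have h1 : K.lower r ≤ K.lnorm :=
      Finset.single_le_sum (f := K.lower) (fun _ _ => Nat.zero_le _) (Finset.mem_univ r)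
    have h2 : K.lnorm ≤ m := (le_max_left _ _).trans hK
    exact ⟨by omega, le_trans (by exact_mod_cast Nat.sub_le _ _) (hCK r).2⟩
  · rw [Multiset.count_erase_of_ne hr]
    exact hCK r

theorem Set.ncard_le_card_of_subset_range {ι α : Type} [Fintype ι] {s : Set α} (g : ι → α)
    (h : s ⊆ Set.range g) : s.ncard ≤ Fintype.card ι := by
  refine (Set.ncard_le_ncard h (Set.finite_range g)).trans ?_
  rw [← Set.image_univ, ← Nat.card_eq_fintype_card, ← Set.ncard_univ]
  exact Set.ncard_image_le

theorem Cube.norm_le_card {Q : Type} [Fintype Q] {K : Cube Q} (h1 : ∀ q, K.lower q ≤ 1)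
    (h2 : ∀ q, (K.upper q).toNat ≤ 1) : K.norm ≤ Fintype.card Q := by
  rw [Fintype.card_eq_sum_ones]
  exact max_le (Finset.sum_le_sum fun q _ => h1 q) (Finset.sum_le_sum fun q _ => h2 q)

namespace CounterState

variable {n : ℕ}

/-- The level of a state of the counter; `tok` and `sent` have none. -/
def level : CounterState n → Option (Fin n)
  | tok | sent => none
  | a i | b i | c i => some i

/-- The number of tokens that must have been sent to bring a process of the counter to a state. -/
def weight : CounterState n → ℕ
  | tok | sent | a _ => 0
  | b i => 2 ^ i.val
  | c i => 2 ^ (i.val + 1)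

theorem count_level_none (C : Multiset (CounterState n)) :
    (C.map level).count none = C.count tok + C.count sent := by
  induction C using Multiset.induction_on with
  | empty => simp
  | cons x C ih => cases x <;> simp [level, ih] <;> omega

theorem count_level_some (C : Multiset (CounterState n)) (i : Fin n) :
    (C.map level).count (some i) = C.count (a i) + C.count (b i) + C.count (c i) := by
  induction C using Multiset.induction_on with
  | empty => simp
  | cons x C ih => cases x <;> simp [level, ih, Multiset.count_cons] <;> split_ifs <;> omega

end CounterState

section BroadcastCounter

open CounterState

theorem CounterTrans.level_eq {n : ℕ} {p q : CounterState n} {x : BroadcastAction (Fin (n + 1))}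
    (h : CounterTrans n (p, x, q)) : p.level = q.level := by
  cases h <;> rfl

theorem CounterTrans.of_recv {n : ℕ} {p q : CounterState n} {j : Fin (n + 1)}
    (h : CounterTrans n (p, .recv j, q)) : ∃ i : Fin n, j = i.castSucc ∧ p.level = some i ∧
      q.weight = p.weight + 2 ^ j.val := by
  cases h with
  | ab i => exact ⟨i, rfl, rfl, by simp [weight]⟩
  | bc i => exact ⟨i, rfl, rfl, by simp [weight]; ring⟩

theorem CounterTrans.of_send {n : ℕ} {p q : CounterState n} {j : Fin (n + 1)}
    (h : CounterTrans n (p, .send j, q)) :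
    q.weight + 2 ^ j.val + ({p} : Multiset _).count sent ≤
      p.weight + ({q} : Multiset _).count sent := by
  cases h with
  | tok => simp [weight]
  | ca i => simp [weight]

theorem counterRBN_level_eq {n : ℕ} {C C' : Multiset (CounterState n)}
    (h : Relation.ReflTransGen (counterRBN n).Step C C') : C'.map level = C.map level := by
  induction h with
  | refl => rfl
  | tail _ hstep ih =>
    obtain ⟨j, p, q, ts, D, hsend, hrecv, rfl, rfl⟩ := hstep
    rw [← ih]
    have hts : (ts.map Prod.snd).map level = (ts.map Prod.fst).map level := by
      rw [Multiset.map_map, Multiset.map_map]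
      exact Multiset.map_congr rfl fun t ht => (CounterTrans.level_eq (hrecv t ht)).symm
    rw [Multiset.map_add, Multiset.map_add, Multiset.map_add, Multiset.map_add, hts,
      Multiset.map_singleton, Multiset.map_singleton, CounterTrans.level_eq hsend]

/-- As long as no two processes share a level, the total weight stays bounded by the number of
tokens sent: a broadcast is received by at most one process, whose weight grows by no more than
what the sender pays. -/
theorem counter_step_weight_le {n : ℕ} {j : Fin (n + 1)} {p q : CounterState n}
    {ts : Multiset (CounterState n × CounterState n)} {D : Multiset (CounterState n)}
    (hsend : CounterTrans n (p, .send j, q)) (hrecv : ∀ t ∈ ts, CounterTrans n (t.1, .recv j, t.2))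
    (hlevel : ∀ i, (({p} + ts.map Prod.fst + D).map level).count (some i) ≤ 1)
    (h : (({p} + ts.map Prod.fst + D).map weight).sum ≤ ({p} + ts.map Prod.fst + D).count sent) :
    (({q} + ts.map Prod.snd + D).map weight).sum ≤ ({q} + ts.map Prod.snd + D).count sent := by
  have hcard : ts.card ≤ 1 := by
    rcases ts.empty_or_exists_mem with rfl | ⟨t, ht⟩
    · simp
    · obtain ⟨i, hi, -⟩ := (hrecv t ht).of_recv
      have hrep : (ts.map Prod.fst).map level = ts.card • {some i} := by
        rw [Multiset.map_map]
        refine Multiset.map_eq_nsmul_singleton fun s hs => ?_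
        obtain ⟨i', hi', hs', -⟩ := (hrecv s hs).of_recv
        have : i' = i := Fin.castSucc_injective n (hi'.symm.trans hi)
        exact this ▸ hs'
      have := hlevel i
      rw [Multiset.map_add, Multiset.map_add, hrep, Multiset.count_add, Multiset.count_add,
        Multiset.count_nsmul, Multiset.count_singleton_self] at this
      omega
  have hsum : ((ts.map Prod.snd).map weight).sum ≤
      ((ts.map Prod.fst).map weight).sum + 2 ^ j.val := by
    have : (ts.map Prod.snd).map weight = ts.map fun t => t.1.weight + 2 ^ j.val := by
      rw [Multiset.map_map]
      refine Multiset.map_congr rfl fun t ht => ?_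
      obtain ⟨-, -, -, ht⟩ := (hrecv t ht).of_recv
      exact ht
    rw [this, Multiset.sum_map_add, Multiset.map_const', Multiset.sum_replicate, smul_eq_mul,
      Multiset.map_map]
    exact Nat.add_le_add_left ((Nat.mul_le_mul_right _ hcard).trans (one_mul _).le) _
  have hrecv_sent : (ts.map Prod.fst).count sent = 0 := by
    rw [Multiset.count_eq_zero]
    intro hmem
    obtain ⟨t, ht, hts⟩ := Multiset.mem_map.1 hmem
    obtain ⟨i, -, hi, -⟩ := (hrecv t ht).of_recv
    rw [hts] at hi
    cases hi
  have hpay := hsend.of_send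
  simp only [Multiset.map_add, Multiset.sum_add, Multiset.count_add, Multiset.map_singleton,
    Multiset.sum_singleton] at h ⊢
  omega

theorem counterRBN_weight_le {n : ℕ} {C C' : Multiset (CounterState n)}
    (hlevel : ∀ i, (C.map level).count (some i) ≤ 1) (hC : (C.map weight).sum ≤ C.count sent)
    (h : Relation.ReflTransGen (counterRBN n).Step C C') :
    (C'.map weight).sum ≤ C'.count sent := by
  induction h with
  | refl => exact hC
  | tail hreach hstep ih =>
    have hlev := counterRBN_level_eq hreach
    obtain ⟨j, p, q, ts, D, hsend, hrecv, rfl, rfl⟩ := hstep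
    rw [← hlev] at hlevel
    exact counter_step_weight_le hsend hrecv hlevel ih

theorem mem_counterInit_iff {n : ℕ} {C : Multiset (CounterState n)} :
    C ∈ (counterInit n).toSet ↔ C = C.count tok • {tok} + (levelsBelow n n).map a := by
  have ha : ∀ i : Fin n, ((levelsBelow n n).map a).count (a i) = 1 :=
    count_map_levelsBelow_self fun _ _ h => CounterState.a.inj h
  rw [Cube.mem_toSet]
  constructor
  · intro h
    ext x
    have hx := h x
    cases x with
    | a i =>
      simp only [counterInit] at hx
      have := le_antisymm (by exact_mod_cast hx.2) hx.1
      simp [ha, this]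
    | tok => simp [Multiset.count_nsmul]
    | _ =>
      simp only [counterInit, nonpos_iff_eq_zero, Nat.cast_eq_zero] at hx
      simp [hx.2]
  · intro h x
    rw [h]
    cases x <;> simp [counterInit, Multiset.count_nsmul, ha]

theorem mem_counterFinal_iff {n : ℕ} {C : Multiset (CounterState n)} (hn : 1 ≤ n) :
    C ∈ (counterFinal n).toSet ↔ c ⟨n - 1, by omega⟩ ∈ C := by
  rw [Cube.mem_toSet, ← Multiset.one_le_count_iff_mem]
  constructor
  · intro h
    have := (h (c ⟨n - 1, by omega⟩)).1
    simpa [counterFinal, Nat.sub_add_cancel hn] using this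
  · intro h x
    refine ⟨?_, le_top⟩
    cases x with
    | c i =>
      simp only [counterFinal]
      split_ifs with hi
      · have : i = ⟨n - 1, by omega⟩ := Fin.ext (by simp; omega)
        rwa [this]
      · exact Nat.zero_le _
    | _ => exact Nat.zero_le _

/-- Covering the last state `c` requires `2 ^ n` sent tokens, and tokens are never created. -/
theorem counterRBN_two_pow_le {n : ℕ} (hn : 1 ≤ n) {C C' : Multiset (CounterState n)}
    (hC : C ∈ (counterInit n).toSet) (h : Relation.ReflTransGen (counterRBN n).Step C C')
    (hC' : C' ∈ (counterFinal n).toSet) :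
    2 ^ n ≤ C'.count sent ∧ C'.count tok + C'.count sent = C.count tok := by
  rw [mem_counterFinal_iff hn] at hC'
  have hnil : ∀ x : CounterState n, x ≠ tok → (∀ i, x ≠ a i) → C.count x = 0 := by
    intro x hx hx'
    have := (Cube.mem_toSet.1 hC x).2
    cases x <;> simp_all [counterInit]
  have hone : ∀ i, C.count (a i) = 1 := by
    intro i
    obtain ⟨h1, h2⟩ := Cube.mem_toSet.1 hC (a i)
    simp only [counterInit] at h1 h2
    exact le_antisymm (by exact_mod_cast h2) h1
  have hw : (C'.map weight).sum ≤ C'.count sent := by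
    refine counterRBN_weight_le (fun i => ?_) ?_ h
    · rw [count_level_some, hone, hnil _ (by simp) (by simp), hnil _ (by simp) (by simp)]
    · rw [mem_counterInit_iff.1 hC]
      simp [weight, Multiset.map_nsmul, Multiset.sum_nsmul, Function.comp_def]
  refine ⟨?_, ?_⟩
  · have := Multiset.le_sum_of_mem (Multiset.mem_map_of_mem weight hC')
    simp only [weight, Nat.sub_add_cancel hn] at this
    exact this.trans hw
  · rw [← count_level_none, counterRBN_level_eq h, count_level_none,
      hnil sent (by simp) (by simp), add_zero]

/-- If `2 ^ i` tokens and the lower levels can produce one broadcast of the letter of level `i`,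
then twice as many tokens bring the process of level `i` from `a` to `c`. -/
theorem counterRBN_advance_level {n i : ℕ} (hi : i < n)
    (hbroadcast : ∀ ts : Multiset (CounterState n × CounterState n),
      (∀ t ∈ ts, CounterTrans n (t.1, .recv ⟨i, hi.trans n.lt_succ_self⟩, t.2)) → ∀ D,
      Relation.ReflTransGen (counterRBN n).Step
        (2 ^ i • {tok} + (levelsBelow n i).map a + ts.map Prod.fst + D)
        (2 ^ i • {sent} + (levelsBelow n i).map a + ts.map Prod.snd + D))
    (D : Multiset (CounterState n)) :
    Relation.ReflTransGen (counterRBN n).Step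
      (2 ^ (i + 1) • {tok} + (levelsBelow n (i + 1)).map a + D)
      (2 ^ (i + 1) • {sent} + (levelsBelow n i).map a + {c ⟨i, hi⟩} + D) := by
  have h1 := hbroadcast {(a ⟨i, hi⟩, b ⟨i, hi⟩)} (by
    intro t ht
    rw [Multiset.mem_singleton.1 ht]
    exact CounterTrans.ab ⟨i, hi⟩) (2 ^ i • {tok} + D)
  have h2 := hbroadcast {(b ⟨i, hi⟩, c ⟨i, hi⟩)} (by
    intro t ht
    rw [Multiset.mem_singleton.1 ht]
    exact CounterTrans.bc ⟨i, hi⟩) (2 ^ i • {sent} + D)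
  simp only [Multiset.map_singleton] at h1 h2
  rw [levelsBelow_succ hi, Multiset.map_cons, ← Multiset.singleton_add, pow_succ, mul_two,
    add_nsmul, add_nsmul]
  have e : 2 ^ i • {sent} + (levelsBelow n i).map a + {b ⟨i, hi⟩} + (2 ^ i • {tok} + D) =
      2 ^ i • {tok} + (levelsBelow n i).map a + {b ⟨i, hi⟩} + (2 ^ i • {sent} + D) := by abel
  rw [e] at h1
  convert h1.trans h2 using 1 <;> abel

/-- From `2 ^ i` tokens the lower levels produce one broadcast of the letter of level `i`, and
return to their initial states. -/
theorem counterRBN_broadcast {n i : ℕ} (hi : i < n + 1)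
    (ts : Multiset (CounterState n × CounterState n))
    (hts : ∀ t ∈ ts, CounterTrans n (t.1, .recv ⟨i, hi⟩, t.2)) (D : Multiset (CounterState n)) :
    Relation.ReflTransGen (counterRBN n).Step
      (2 ^ i • {tok} + (levelsBelow n i).map a + ts.map Prod.fst + D)
      (2 ^ i • {sent} + (levelsBelow n i).map a + ts.map Prod.snd + D) := by
  induction i generalizing ts D with
  | zero =>
    refine .single ⟨0, tok, sent, ts, D, CounterTrans.tok, hts, ?_, ?_⟩ <;>
      simp [levelsBelow_zero]
  | succ i ih =>
    have hi' : i < n := by omega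
    have h := counterRBN_advance_level hi' (ih (by omega)) (ts.map Prod.fst + D)
    rw [← add_assoc] at h
    refine h.tail ⟨⟨i + 1, hi⟩, c ⟨i, hi'⟩, a ⟨i, hi'⟩, ts,
      2 ^ (i + 1) • {sent} + (levelsBelow n i).map a + D, CounterTrans.ca ⟨i, hi'⟩, hts, ?_, ?_⟩
    · abel
    · rw [levelsBelow_succ hi', Multiset.map_cons, ← Multiset.singleton_add]
      abel

theorem counterRBN_cover_iff {n m : ℕ} (hn : 1 ≤ n) :
    (∃ C ∈ (counterInit n).toSet, C.count tok = m ∧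
      ∃ C' ∈ (counterFinal n).toSet, Relation.ReflTransGen (counterRBN n).Step C C') ↔
    2 ^ n ≤ m := by
  constructor
  · rintro ⟨C, hC, rfl, C', hC', h⟩
    obtain ⟨h1, h2⟩ := counterRBN_two_pow_le hn hC h hC'
    omega
  · intro h
    have htok : (m • {tok} + (levelsBelow n n).map a).count tok = m := by
      rw [Multiset.count_add, Multiset.count_nsmul, Multiset.count_singleton_self, mul_one,
        count_map_levelsBelow_of_ne (by simp), add_zero]
    refine ⟨m • {tok} + (levelsBelow n n).map a, mem_counterInit_iff.2 (by rw [htok]), htok, ?_⟩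
    obtain ⟨k, rfl⟩ : ∃ k, n = k + 1 := ⟨n - 1, by omega⟩
    have := counterRBN_advance_level (Nat.lt_succ_self k) (counterRBN_broadcast _)
      ((m - 2 ^ (k + 1)) • {tok})
    rw [add_right_comm, ← add_nsmul, Nat.add_sub_cancel' h] at this
    exact ⟨_, (mem_counterFinal_iff hn).2 (by simp), this⟩

theorem counterRBN_not_isCountingSetOfNormLE {n m : ℕ} (hn : 1 ≤ n) (hm : m < 2 ^ n) :
    ¬ IsCountingSetOfNormLE (postStar (counterRBN n).Step (counterInit n).toSet) m := by
  intro hS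
  obtain ⟨C, hC, htok, C', hC', h⟩ := (counterRBN_cover_iff (m := 2 ^ n) hn).2 le_rfl
  obtain ⟨h1, h2⟩ := counterRBN_two_pow_le hn hC h hC'
  -- Dropping one of the `2 ^ n` tokens sent contradicts the lower bound on their number.
  obtain ⟨C₀, hC₀, h'⟩ := hS.erase_mem (q := sent) ⟨C, hC, h⟩ (hm.trans_le h1)
  have hfin : C'.erase sent ∈ (counterFinal n).toSet := by
    rw [mem_counterFinal_iff hn] at hC' ⊢
    rwa [Multiset.mem_erase_of_ne (by simp)]
  have h3 := (counterRBN_two_pow_le hn hC₀ h' hfin).1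
  rw [Multiset.count_erase_self] at h3
  have : 0 < 2 ^ n := by positivity
  omega

theorem CounterState.card_le (n : ℕ) : Fintype.card (CounterState n) ≤ 3 * n + 2 := by
  refine (Fintype.card_le_of_surjective
    (Sum.elim (fun x : Bool => if x then tok else sent) (Sum.elim a (Sum.elim b c)) :
      Bool ⊕ Fin n ⊕ Fin n ⊕ Fin n → CounterState n) ?_).trans ?_
  · intro x
    cases x with
    | tok => exact ⟨.inl true, rfl⟩
    | sent => exact ⟨.inl false, rfl⟩
    | a i => exact ⟨.inr (.inl i), rfl⟩
    | b i => exact ⟨.inr (.inr (.inl i)), rfl⟩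
    | c i => exact ⟨.inr (.inr (.inr i)), rfl⟩
  · simp only [Fintype.card_sum, Fintype.card_bool, Fintype.card_fin]
    omega

theorem counterRBN_size_le (n : ℕ) : (counterRBN n).toSystem.size ≤ 7 * n + 4 := by
  have h1 : {t | CounterTrans n t}.ncard ≤ 3 * n + 1 := by
    refine (Set.ncard_le_card_of_subset_range
      (Sum.elim (fun _ => (tok, .send 0, sent)) (Sum.elim (fun i => (a i, .recv i.castSucc, b i))
        (Sum.elim (fun i => (b i, .recv i.castSucc, c i)) fun i => (c i, .send i.succ, a i))) :
        Unit ⊕ Fin n ⊕ Fin n ⊕ Fin n → _) ?_).trans ?_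
    · intro t ht
      cases ht with
      | tok => exact ⟨.inl (), rfl⟩
      | ab i => exact ⟨.inr (.inl i), rfl⟩
      | bc i => exact ⟨.inr (.inr (.inl i)), rfl⟩
      | ca i => exact ⟨.inr (.inr (.inr i)), rfl⟩
    · simp only [Fintype.card_sum, Fintype.card_unit, Fintype.card_fin]
      omega
  have h2 := CounterState.card_le n
  change Fintype.card (CounterState n) + Fintype.card (Fin (n + 1)) +
    {t | CounterTrans n t}.ncard ≤ _
  rw [Fintype.card_fin]
  omega

theorem countingNorm_counterInit_le (n : ℕ) : countingNorm (counterInit n).toSet ≤ 3 * n + 2 := by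
  refine ((counterInit n).isCountingSetOfNormLE.2.trans (Cube.norm_le_card ?_ ?_)).trans
    (CounterState.card_le n) <;>
  · intro x
    cases x <;> simp [counterInit]

end BroadcastCounter

/-! ### The counter as a shared-memory system -/

/-- The states of the counter with a shared register: as in the broadcast counter, a process of
level `i` consumes two messages `i`, at `a i` and at `c i`, and then sends one message `i + 1`. -/
inductive RegisterCounterState (n : ℕ) where
  | tok
  | sent
  | a (i : Fin n)
  | b (i : Fin n)
  | c (i : Fin n)
  | d (i : Fin n)
deriving DecidableEq, Fintype

/-- The register holds a message `some j` or is blank. A process that has read its first message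
blanks the register, so that it cannot read the same message again. -/
inductive RegisterCounterTrans (n : ℕ) :
    RegisterCounterState n × RegisterOp × Option (Fin (n + 1)) × RegisterCounterState n → Prop
  | tok : RegisterCounterTrans n (.tok, .write, some 0, .sent)
  | ab (i : Fin n) : RegisterCounterTrans n (.a i, .read, some i.castSucc, .b i)
  | bc (i : Fin n) : RegisterCounterTrans n (.b i, .write, none, .c i)
  | cd (i : Fin n) : RegisterCounterTrans n (.c i, .read, some i.castSucc, .d i)
  | da (i : Fin n) : RegisterCounterTrans n (.d i, .write, some i.succ, .a i)

/-- The counter to `2 ^ n` with messages passed through a register. -/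
abbrev registerCounter (n : ℕ) : ASMS where
  State := RegisterCounterState n
  Letter := Option (Fin (n + 1))
  δ := {t | RegisterCounterTrans n t}

theorem ASMS.config_inj {P : ASMS} {M M' : Multiset P.State} {d d' : P.Letter} :
    P.config M d = P.config M' d' ↔ M = M' ∧ d = d' := by
  refine ⟨fun h => ?_, fun ⟨h, h'⟩ => by rw [h, h']⟩
  unfold ASMS.config at h
  have hd : d = d' := by
    have : Sum.inr d ∈ M'.map Sum.inl + {Sum.inr d'} := h ▸ by simp
    simpa using this
  subst hd
  exact ⟨Multiset.map_injective Sum.inl_injective (add_right_cancel h), rfl⟩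

namespace RegisterCounterState

variable {n : ℕ}

/-- The level of a state of the counter; `tok` and `sent` have none. -/
def level : RegisterCounterState n → Option (Fin n)
  | tok | sent => none
  | a i | b i | c i | d i => some i

/-- The number of tokens spent on the messages that a process has read. -/
def weight : RegisterCounterState n → ℕ
  | tok | sent | a _ => 0
  | b i | c i => 2 ^ i.val
  | d i => 2 ^ (i.val + 1)

/-- The number of tokens spent on the register value `r`, counted at a process that can read it. -/
def pending (r : Option (Fin (n + 1))) : RegisterCounterState n → ℕ
  | a i | c i => if r = some i.castSucc then 2 ^ i.val else 0
  | _ => 0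

theorem count_level_some (M : Multiset (RegisterCounterState n)) (i : Fin n) :
    (M.map level).count (some i) =
      M.count (a i) + M.count (b i) + M.count (c i) + M.count (d i) := by
  induction M using Multiset.induction_on with
  | empty => simp
  | cons x M ih => cases x <;> simp [level, ih, Multiset.count_cons] <;> split_ifs <;> omega

theorem sum_pending_none (M : Multiset (RegisterCounterState n)) :
    (M.map (pending none)).sum = 0 := by
  refine Multiset.sum_eq_zero fun x hx => ?_
  obtain ⟨y, -, rfl⟩ := Multiset.mem_map.1 hx
  cases y <;> rfl

/-- A message in the register is pending for at most one process, as no two share a level. The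
last message `n` is read by nobody. -/
theorem sum_pending_some_le (M : Multiset (RegisterCounterState n)) (j : Fin (n + 1))
    (hlevel : ∀ i, (M.map level).count (some i) ≤ 1) :
    (M.map (pending (some j))).sum ≤ 2 ^ j.val := by
  induction j using Fin.lastCases with
  | last =>
    refine (Multiset.sum_eq_zero fun x hx => ?_).trans_le (Nat.zero_le _)
    obtain ⟨y, -, rfl⟩ := Multiset.mem_map.1 hx
    cases y <;> simp [pending, Fin.ext_iff] <;> omega
  | cast i =>
    have key : ∀ M : Multiset (RegisterCounterState n),
        (M.map (pending (some i.castSucc))).sum ≤ (M.map level).count (some i) * 2 ^ i.val := by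
      intro M
      induction M using Multiset.induction_on with
      | empty => simp
      | cons x M ih =>
        have hx : pending (some i.castSucc) x ≤ if some i = level x then 2 ^ i.val else 0 := by
          cases x <;> simp only [pending, level, Option.some.injEq, Fin.castSucc_inj] <;>
            split_ifs with h <;> simp_all
        rw [Multiset.map_cons, Multiset.map_cons, Multiset.sum_cons, Multiset.count_cons, add_mul,
          add_comm]
        refine Nat.add_le_add ih (hx.trans (le_of_eq ?_))
        split_ifs <;> simp
    exact (key M).trans ((Nat.mul_le_mul_right _ (hlevel i)).trans (one_mul _).le)

end RegisterCounterState

section RegisterCounter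

open RegisterCounterState

theorem RegisterCounterTrans.level_eq {n : ℕ} {p q : RegisterCounterState n} {o : RegisterOp}
    {r : Option (Fin (n + 1))} (h : RegisterCounterTrans n (p, o, r, q)) :
    p.level = q.level := by
  cases h <;> rfl

/-- As long as no two processes share a level, the tokens sent pay for the messages that have been
read and for the message in the register. -/
theorem registerCounter_step_weight_le {n : ℕ} {p q : RegisterCounterState n}
    {r r' : Option (Fin (n + 1))} {D : Multiset (RegisterCounterState n)}
    (h : RegisterCounterTrans n (p, .read, r, q) ∧ r' = r ∨
      RegisterCounterTrans n (p, .write, r', q))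
    (hlevel : ∀ i, (({p} + D).map level).count (some i) ≤ 1)
    (hw : (({p} + D).map weight).sum + (({p} + D).map (pending r)).sum ≤ ({p} + D).count sent) :
    (({q} + D).map weight).sum + (({q} + D).map (pending r')).sum ≤ ({q} + D).count sent := by
  have hlevel' : ∀ i, (({q} + D).map level).count (some i) ≤ 1 := by
    have : q.level = p.level := by
      rcases h with ⟨h, -⟩ | h <;> exact h.level_eq.symm
    rw [Multiset.map_add, Multiset.map_singleton] at hlevel ⊢
    rwa [this]
  have hsome : ∀ j, (({q} + D).map (pending (some j))).sum ≤ 2 ^ j.val :=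
    fun j => sum_pending_some_le _ j hlevel'
  have hnone := sum_pending_none ({q} + D)
  simp only [Multiset.map_add, Multiset.sum_add, Multiset.count_add, Multiset.map_singleton,
    Multiset.sum_singleton] at hw hsome hnone ⊢
  rcases h with ⟨h, rfl⟩ | h
  · cases h with
    | ab i =>
      simp [weight, pending] at hw ⊢
      omega
    | cd i =>
      simp [weight, pending, pow_succ] at hw ⊢
      omega
  · cases h with
    | tok =>
      have := hsome 0
      simp [weight, pending] at hw this ⊢
      omega
    | bc i =>
      simp [weight, pending] at hw hnone ⊢
      omega
    | da i =>
      have := hsome i.succ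
      simp [weight, pending] at hw this ⊢
      omega

theorem registerCounter_reach {n : ℕ} {M : Multiset (RegisterCounterState n)}
    {r : Option (Fin (n + 1))} {X : Multiset (RegisterCounterState n ⊕ Option (Fin (n + 1)))}
    (hlevel : ∀ i, (M.map level).count (some i) ≤ 1)
    (hw : (M.map weight).sum + (M.map (pending r)).sum ≤ M.count sent)
    (h : Relation.ReflTransGen (registerCounter n).Step ((registerCounter n).config M r) X) :
    ∃ M' r', X = (registerCounter n).config M' r' ∧ M'.map level = M.map level ∧
      (M'.map weight).sum + (M'.map (pending r')).sum ≤ M'.count sent := by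
  induction h with
  | refl => exact ⟨M, r, rfl, rfl, hw⟩
  | tail _ hstep ih =>
    obtain ⟨M₁, r₁, hX, hlev, hw₁⟩ := ih
    obtain ⟨p, q, s, s', D, hX', rfl, htrans⟩ := hstep
    obtain ⟨rfl, rfl⟩ := ASMS.config_inj.1 (hX.symm.trans hX')
    refine ⟨{q} + D, s', rfl, ?_, registerCounter_step_weight_le htrans (hlev ▸ hlevel) hw₁⟩
    rw [← hlev, Multiset.map_add, Multiset.map_add, Multiset.map_singleton, Multiset.map_singleton]
    have : p.level = q.level := by
      rcases htrans with ⟨h, -⟩ | h <;> exact RegisterCounterTrans.level_eq h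
    rw [this]

/-- Arbitrarily many processes in `tok`, exactly one in each `a i`, none elsewhere, and a blank
register. -/
def registerCounterInit (n : ℕ) : Cube (RegisterCounterState n ⊕ Option (Fin (n + 1))) where
  lower
    | .inl (.a _) => 1
    | .inr none => 1
    | _ => 0
  upper
    | .inl .tok => ⊤
    | .inl (.a _) => 1
    | .inr none => 1
    | _ => 0

theorem mem_registerCounterInit_iff {n : ℕ}
    {X : Multiset (RegisterCounterState n ⊕ Option (Fin (n + 1)))} :
    X ∈ (registerCounterInit n).toSet ↔ ∃ m : ℕ, X = (registerCounter n).config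
      (m • {tok} + (levelsBelow n n).map a) none := by
  have ha : ∀ i : Fin n, ((levelsBelow n n).map a).count (a i) = 1 :=
    count_map_levelsBelow_self fun _ _ h => RegisterCounterState.a.inj h
  have hinl : ∀ (M : Multiset (RegisterCounterState n)) r x,
      ((registerCounter n).config M r).count (Sum.inl x) = M.count x := by
    intro M r x
    rw [ASMS.config, Multiset.count_add, Multiset.count_map_eq_count' _ _ Sum.inl_injective]
    simp
  have hinr : ∀ (M : Multiset (RegisterCounterState n)) r r',
      ((registerCounter n).config M r).count (Sum.inr r') = if r' = r then 1 else 0 := by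
    intro M r r'
    rw [ASMS.config, Multiset.count_add, Multiset.count_singleton]
    simp
  rw [Cube.mem_toSet]
  constructor
  · intro h
    refine ⟨X.count (Sum.inl tok), ?_⟩
    ext x
    have hx := h x
    rcases x with x | x
    · rw [hinl]
      cases x with
      | a i =>
        simp only [registerCounterInit] at hx
        have := le_antisymm (by exact_mod_cast hx.2) hx.1
        simp [ha, this]
      | tok => simp [Multiset.count_nsmul]
      | _ =>
        simp only [registerCounterInit, nonpos_iff_eq_zero, Nat.cast_eq_zero] at hx
        simp [hx.2]
    · rw [hinr]
      cases x with
      | none =>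
        simp only [registerCounterInit] at hx
        simp [le_antisymm (by exact_mod_cast hx.2) hx.1]
      | some j =>
        simp only [registerCounterInit, nonpos_iff_eq_zero, Nat.cast_eq_zero] at hx
        simp [hx.2]
  · rintro ⟨m, rfl⟩ (x | x)
    · rw [hinl]
      cases x <;> simp [registerCounterInit, Multiset.count_nsmul, ha]
    · rw [hinr]
      cases x <;> simp [registerCounterInit]

/-- Covering the last state `d` requires `2 ^ n` sent tokens. -/
theorem registerCounter_two_pow_le {n m : ℕ} (hn : 1 ≤ n) {M : Multiset (RegisterCounterState n)}
    {r : Option (Fin (n + 1))}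
    (h : Relation.ReflTransGen (registerCounter n).Step
      ((registerCounter n).config (m • {tok} + (levelsBelow n n).map a) none)
      ((registerCounter n).config M r))
    (hd : d ⟨n - 1, by omega⟩ ∈ M) :
    2 ^ n ≤ M.count sent := by
  obtain ⟨M', r', e, -, hw⟩ := registerCounter_reach (fun i => by
      rw [count_level_some]
      simp [count_map_levelsBelow_self (fun _ _ h => RegisterCounterState.a.inj h) i])
    (by simp [weight, pending, Multiset.map_nsmul, Multiset.sum_nsmul, Function.comp_def]) h
  obtain ⟨rfl, rfl⟩ := ASMS.config_inj.1 e
  have := Multiset.le_sum_of_mem (Multiset.mem_map_of_mem weight hd)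
  simp only [weight, Nat.sub_add_cancel hn] at this
  omega

theorem registerCounter_step {n : ℕ} {p q : RegisterCounterState n} {r r' : Option (Fin (n + 1))}
    (h : RegisterCounterTrans n (p, .read, r, q) ∧ r' = r ∨
      RegisterCounterTrans n (p, .write, r', q))
    {M M' : Multiset (RegisterCounterState n)} (D : Multiset (RegisterCounterState n))
    (hM : M = {p} + D) (hM' : M' = {q} + D) :
    (registerCounter n).Step ((registerCounter n).config M r) ((registerCounter n).config M' r') :=
  ⟨p, q, r, r', D, by rw [hM], by rw [hM'], h⟩

/-- If `2 ^ i` tokens and the lower levels can produce the message `i`, then twice as many tokens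
bring the process of level `i` from `a` to `d`. -/
theorem registerCounter_advance_level {n i : ℕ} (hi : i < n)
    (hmessage : ∀ D r, Relation.ReflTransGen (registerCounter n).Step
      ((registerCounter n).config (2 ^ i • {tok} + (levelsBelow n i).map a + D) r)
      ((registerCounter n).config (2 ^ i • {sent} + (levelsBelow n i).map a + D)
        (some ⟨i, hi.trans n.lt_succ_self⟩)))
    (D : Multiset (RegisterCounterState n)) (r : Option (Fin (n + 1))) :
    Relation.ReflTransGen (registerCounter n).Step
      ((registerCounter n).config (2 ^ (i + 1) • {tok} + (levelsBelow n (i + 1)).map a + D) r)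
      ((registerCounter n).config
        (2 ^ (i + 1) • {sent} + (levelsBelow n i).map a + {d ⟨i, hi⟩} + D)
        (some ⟨i, hi.trans n.lt_succ_self⟩)) := by
  rw [levelsBelow_succ hi, Multiset.map_cons, ← Multiset.singleton_add, pow_succ, mul_two,
    add_nsmul, add_nsmul]
  generalize (levelsBelow n i).map a = A at *
  have h1 := hmessage ({a ⟨i, hi⟩} + (2 ^ i • {tok} + D)) r
  have h2 := hmessage ({c ⟨i, hi⟩} + (2 ^ i • {sent} + D)) none
  generalize 2 ^ i • ({tok} : Multiset (RegisterCounterState n)) = U at *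
  generalize 2 ^ i • ({sent} : Multiset (RegisterCounterState n)) = V at *
  have s1 := registerCounter_step (Or.inl ⟨.ab ⟨i, hi⟩, rfl⟩) (V + A + U + D)
    (M := V + A + ({a ⟨i, hi⟩} + (U + D))) (by abel) rfl
  have s2 := registerCounter_step (r := some (Fin.castSucc ⟨i, hi⟩)) (Or.inr (.bc ⟨i, hi⟩))
    (V + A + U + D) rfl (M' := U + A + ({c ⟨i, hi⟩} + (V + D))) (by abel)
  have s3 := registerCounter_step (Or.inl ⟨.cd ⟨i, hi⟩, rfl⟩) (V + V + A + D)
    (M := V + A + ({c ⟨i, hi⟩} + (V + D))) (by abel)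
    (M' := V + V + A + {d ⟨i, hi⟩} + D) (by abel)
  have e : U + U + ({a ⟨i, hi⟩} + A) + D = U + A + ({a ⟨i, hi⟩} + (U + D)) := by abel
  rw [e]
  exact (((h1.tail s1).tail s2).trans h2).tail s3

/-- From `2 ^ i` tokens the lower levels produce the message `i`, and return to their initial
states. -/
theorem registerCounter_message {n i : ℕ} (hi : i < n + 1) (D : Multiset (RegisterCounterState n))
    (r : Option (Fin (n + 1))) :
    Relation.ReflTransGen (registerCounter n).Step
      ((registerCounter n).config (2 ^ i • {tok} + (levelsBelow n i).map a + D) r)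
      ((registerCounter n).config (2 ^ i • {sent} + (levelsBelow n i).map a + D)
        (some ⟨i, hi⟩)) := by
  induction i generalizing D r with
  | zero =>
    refine .single (registerCounter_step (Or.inr .tok) D ?_ ?_) <;> simp [levelsBelow_zero]
  | succ i ih =>
    have hi' : i < n := by omega
    refine (registerCounter_advance_level hi' (ih (by omega)) D r).tail
      (registerCounter_step (Or.inr (.da ⟨i, hi'⟩))
        (2 ^ (i + 1) • {sent} + (levelsBelow n i).map a + D) ?_ ?_)
    · abel
    · rw [levelsBelow_succ hi', Multiset.map_cons, ← Multiset.singleton_add]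
      abel

theorem registerCounter_not_isCountingSetOfNormLE {n m : ℕ} (hn : 1 ≤ n) (hm : m < 2 ^ n)
    {S : Set (Multiset (RegisterCounterState n ⊕ Option (Fin (n + 1))))}
    (hS : ∀ X, (registerCounter n).toSystem.IsConfig X →
      (X ∈ postStar (registerCounter n).Step (registerCounterInit n).toSet ↔ X ∈ S)) :
    ¬ IsCountingSetOfNormLE S m := by
  intro hm'
  obtain ⟨k, rfl⟩ : ∃ k, n = k + 1 := ⟨n - 1, by omega⟩
  have hreach := registerCounter_advance_level (Nat.lt_succ_self k)
    (registerCounter_message _) 0 none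
  simp only [add_zero] at hreach
  generalize hM : 2 ^ (k + 1) • {sent} + (levelsBelow (k + 1) k).map a + {d ⟨k, Nat.lt_succ_self k⟩}
    = M at hreach
  have hcount : M.count sent = 2 ^ (k + 1) := by
    rw [← hM]
    simp [Multiset.count_nsmul]
  have hd : d ⟨k, Nat.lt_succ_self k⟩ ∈ M.erase sent :=
    (Multiset.mem_erase_of_ne (by simp)).2 (by simp [← hM])
  have hmem := (hS _ ⟨M, _, rfl⟩).1 ⟨_, mem_registerCounterInit_iff.2 ⟨_, rfl⟩, hreach⟩
  -- Dropping one of the tokens sent contradicts the lower bound on their number.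
  have hinl : m < ((registerCounter (k + 1)).config M (some ⟨k, by omega⟩)).count
      (Sum.inl sent) := by
    rw [ASMS.config, Multiset.count_add, Multiset.count_map_eq_count' _ _ Sum.inl_injective, hcount]
    omega
  have herase := hm'.erase_mem hmem hinl
  have hconf : ((registerCounter (k + 1)).config M (some ⟨k, by omega⟩)).erase (Sum.inl sent) =
      (registerCounter (k + 1)).config (M.erase sent) (some ⟨k, by omega⟩) := by
    have hmem' : sent ∈ M := by
      rw [← Multiset.count_pos, hcount]
      positivity
    rw [ASMS.config, ASMS.config, Multiset.map_erase _ Sum.inl_injective,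
      Multiset.erase_add_left_pos _ (Multiset.mem_map_of_mem _ hmem')]
  rw [hconf] at herase
  obtain ⟨X₀, hX₀, h⟩ := (hS _ ⟨_, _, rfl⟩).2 herase
  obtain ⟨m₀, rfl⟩ := mem_registerCounterInit_iff.1 hX₀
  have := registerCounter_two_pow_le hn h hd
  rw [Multiset.count_erase_self, hcount] at this
  have : 0 < 2 ^ (k + 1) := by positivity
  omega

theorem RegisterCounterState.card_le (n : ℕ) :
    Fintype.card (RegisterCounterState n) ≤ 4 * n + 2 := by
  refine (Fintype.card_le_of_surjective
    (Sum.elim (fun x : Bool => if x then tok else sent) (Sum.elim a (Sum.elim b (Sum.elim c d))) :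
      Bool ⊕ Fin n ⊕ Fin n ⊕ Fin n ⊕ Fin n → RegisterCounterState n) ?_).trans ?_
  · intro x
    cases x with
    | tok => exact ⟨.inl true, rfl⟩
    | sent => exact ⟨.inl false, rfl⟩
    | a i => exact ⟨.inr (.inl i), rfl⟩
    | b i => exact ⟨.inr (.inr (.inl i)), rfl⟩
    | c i => exact ⟨.inr (.inr (.inr (.inl i))), rfl⟩
    | d i => exact ⟨.inr (.inr (.inr (.inr i))), rfl⟩
  · simp only [Fintype.card_sum, Fintype.card_bool, Fintype.card_fin]
    omega

theorem registerCounter_size_le (n : ℕ) : (registerCounter n).toSystem.size ≤ 9 * n + 5 := by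
  have h1 : {t | RegisterCounterTrans n t}.ncard ≤ 4 * n + 1 := by
    refine (Set.ncard_le_card_of_subset_range
      (Sum.elim (fun _ => (tok, .write, some 0, sent))
        (Sum.elim (fun i => (a i, .read, some i.castSucc, b i))
          (Sum.elim (fun i => (b i, .write, none, c i))
            (Sum.elim (fun i => (c i, .read, some i.castSucc, d i))
              fun i => (d i, .write, some i.succ, a i)))) :
        Unit ⊕ Fin n ⊕ Fin n ⊕ Fin n ⊕ Fin n → _) ?_).trans ?_
    · intro t ht
      cases ht with
      | tok => exact ⟨.inl (), rfl⟩
      | ab i => exact ⟨.inr (.inl i), rfl⟩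
      | bc i => exact ⟨.inr (.inr (.inl i)), rfl⟩
      | cd i => exact ⟨.inr (.inr (.inr (.inl i))), rfl⟩
      | da i => exact ⟨.inr (.inr (.inr (.inr i))), rfl⟩
    · simp only [Fintype.card_sum, Fintype.card_unit, Fintype.card_fin]
      omega
  have h2 := RegisterCounterState.card_le n
  change Fintype.card (RegisterCounterState n) + Fintype.card (Option (Fin (n + 1))) +
    {t | RegisterCounterTrans n t}.ncard ≤ _
  rw [Fintype.card_option, Fintype.card_fin]
  omega

theorem registerCounterInit_norm_le (n : ℕ) : (registerCounterInit n).norm ≤ 5 * n + 4 := by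
  refine (Cube.norm_le_card ?_ ?_).trans ?_
  · rintro (x | x) <;> cases x <;> simp [registerCounterInit]
  · rintro (x | x) <;> cases x <;> simp [registerCounterInit]
  · have := RegisterCounterState.card_le n
    rw [Fintype.card_sum, Fintype.card_option, Fintype.card_fin]
    omega

end RegisterCounter

/-! ### Impossibility of strong simulation -/

theorem Polynomial.exists_eval_lt_two_pow (P : Polynomial ℕ) : ∃ n, 1 ≤ n ∧ P.eval n < 2 ^ n := by
  have h : Filter.Tendsto (fun n : ℕ => ((P.eval n : ℕ) : ℝ) / 2 ^ n) Filter.atTop (nhds 0) := by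
    induction P using Polynomial.induction_on' with
    | add P Q hP hQ =>
      simpa [add_div] using hP.add hQ
    | monomial k x =>
      simpa [mul_div_assoc] using
        (tendsto_pow_const_div_const_pow_of_one_lt k (one_lt_two (α := ℝ))).const_mul (x : ℝ)
  obtain ⟨n, hn, hn'⟩ :=
    ((h.eventually_lt_const one_pos).and (Filter.eventually_ge_atTop 1)).exists
  rw [div_lt_one (by positivity)] at hn
  exact ⟨n, hn', by exact_mod_cast hn⟩

theorem Polynomial.eval_le_eval_of_le (P : Polynomial ℕ) {x y : ℕ} (h : x ≤ y) :
    P.eval x ≤ P.eval y := by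
  rw [Polynomial.eval_eq_sum, Polynomial.eval_eq_sum]
  exact Finset.sum_le_sum fun k _ => Nat.mul_le_mul_left _ (Nat.pow_le_pow_left h k)

/-- For a simulation of polynomial size, the norm bounds of immediate observation nets eventually
fall below `2 ^ n` on the `n`-th counter. -/
theorem exists_transfer_bound_lt_two_pow (p : Polynomial ℕ) :
    ∃ n, 1 ≤ n ∧ ∀ m s x y : ℕ, m ≤ 5 * n + 4 → s ≤ 9 * n + 5 → x ≤ p.eval s → y ≤ p.eval s →
      3 * (m + x + y) ^ 3 < 2 ^ n := by
  obtain ⟨n, hn, h⟩ := Polynomial.exists_eval_lt_two_pow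
    (3 * (5 * .X + 4 + p.comp (9 * .X + 5) + p.comp (9 * .X + 5)) ^ 3)
  refine ⟨n, hn, fun m s x y hm hs hx hy => lt_of_le_of_lt ?_ h⟩
  have hp := p.eval_le_eval_of_le hs
  simp only [Polynomial.eval_mul, Polynomial.eval_pow, Polynomial.eval_add, Polynomial.eval_comp,
    Polynomial.eval_X, Polynomial.eval_ofNat]
  gcongr
  · exact hx.trans hp
  · exact hy.trans hp

theorem counterRBN_exceeds (c k : ℕ) : ∃ n : ℕ, 1 ≤ n ∧
    ¬ IsCountingSetOfNormLE (postStar (counterRBN n).Step (counterInit n).toSet)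
      (c * (countingNorm (counterInit n).toSet + Fintype.card (CounterState n)) ^ k) := by
  obtain ⟨n, hn, h⟩ := Polynomial.exists_eval_lt_two_pow (.C c * (6 * .X + 4) ^ k)
  refine ⟨n, hn, counterRBN_not_isCountingSetOfNormLE hn (lt_of_le_of_lt ?_ h)⟩
  simp only [Polynomial.eval_mul, Polynomial.eval_pow, Polynomial.eval_add, Polynomial.eval_C,
    Polynomial.eval_X, Polynomial.eval_ofNat]
  have h1 := countingNorm_counterInit_le n
  have h2 := CounterState.card_le n
  exact Nat.mul_le_mul_left _ (Nat.pow_le_pow_left (by omega) _)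

theorem not_stronglySimulates_rbnModel : ¬ StronglySimulates ioModel rbnModel := by
  rintro ⟨p, hp⟩
  obtain ⟨n, hn, hbound⟩ := exists_transfer_bound_lt_two_pow p
  obtain ⟨_, ⟨N, rfl⟩, f, h, hs, hN, hh⟩ := hp _ ⟨counterRBN n, rfl⟩
  have hpost := (RBN.isCountingSetOfNormLE_of_isStrongSimulation hs
    (counterInit n).isCountingSetOfNormLE.1).1
  refine counterRBN_not_isCountingSetOfNormLE hn (hbound _ _ _ _ ?_ ?_ hh ?_) hpost
  · exact (countingNorm_counterInit_le n).trans (by omega)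
  · exact (counterRBN_size_le n).trans (by omega)
  · exact (Nat.le_add_right _ _).trans hN

theorem not_stronglySimulates_asmsModel : ¬ StronglySimulates ioModel asmsModel := by
  rintro ⟨p, hp⟩
  obtain ⟨n, hn, hbound⟩ := exists_transfer_bound_lt_two_pow p
  obtain ⟨_, ⟨N, rfl⟩, f, h, hs, hN, hh⟩ := hp _ ⟨registerCounter n, rfl⟩
  let : Fintype (registerCounter n).toSystem.Place :=
    inferInstanceAs (Fintype (RegisterCounterState n ⊕ Option (Fin (n + 1))))
  obtain ⟨⟨S', hS', hpost⟩, -⟩ := hs.exists_isCountingSetOfNormLE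
    (S := (registerCounterInit n).toSet) (fun X hX => by
      obtain ⟨m, rfl⟩ := mem_registerCounterInit_iff.1 hX
      exact ⟨_, _, rfl⟩) (registerCounterInit n).isCountingSetOfNormLE
  refine registerCounter_not_isCountingSetOfNormLE hn (hbound _ _ _ _ ?_ ?_ hh ?_) hpost hS'
  · exact registerCounterInit_norm_le n
  · exact registerCounter_size_le n
  · exact (Nat.le_add_right _ _).trans hN

theorem mainTheorem2 :
    -- if IO nets could strongly simulate RBN, `post*` and `pre*` of counting sets of RBN would be
    -- counting sets of norm polynomial in the norm of the given set and the number of states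
    (StronglySimulates ioModel rbnModel →
      ∃ c k : ℕ, ∀ (R : RBN) (S : Set (Multiset R.State)), IsCountingSet S →
        IsCountingSetOfNormLE (postStar R.Step S)
          (c * (countingNorm S + Fintype.card R.State) ^ k) ∧
        IsCountingSetOfNormLE (preStar R.Step S)
          (c * (countingNorm S + Fintype.card R.State) ^ k)) ∧
    -- the transfer for each single RBN that some IO net strongly simulates
    (∃ c k : ℕ, ∀ (R : RBN) (N : IONet)
      (f : R.toSystem.Place ↪ N.toSystem.Place) (h : Multiset N.toSystem.Place),
      IsStrongSimulation R.toSystem N.toSystem f h →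
      ∀ S : Set (Multiset R.State), IsCountingSet S →
        IsCountingSetOfNormLE (postStar R.Step S)
          (c * (countingNorm S + h.card + Fintype.card N.State) ^ k) ∧
        IsCountingSetOfNormLE (preStar R.Step S)
          (c * (countingNorm S + h.card + Fintype.card N.State) ^ k)) ∧
    -- `R_n` can cover `c_n` with `m` initial tokens exactly when `m` is at least `2 ^ n`
    (∀ n m : ℕ, 1 ≤ n →
      ((∃ C ∈ (counterInit n).toSet, C.count CounterState.tok = m ∧
          ∃ C' ∈ (counterFinal n).toSet,
            Relation.ReflTransGen (counterRBN n).Step C C') ↔ 2 ^ n ≤ m)) ∧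
    -- the family `R_n` violates every polynomial bound of the above kind
    (∀ c k : ℕ, ∃ n : ℕ, 1 ≤ n ∧
      ¬ IsCountingSetOfNormLE (postStar (counterRBN n).Step (counterInit n).toSet)
          (c * (countingNorm (counterInit n).toSet + Fintype.card (CounterState n)) ^ k)) ∧
    -- IO nets strongly simulate neither RBN nor ASMS
    ¬ StronglySimulates ioModel rbnModel ∧
    ¬ StronglySimulates ioModel asmsModel := by
  -- The hypothesis of the first implication is refuted.
  exact ⟨fun h => absurd h not_stronglySimulates_rbnModel,
    ⟨3, 3, fun _ _ _ _ hs _ hS => RBN.isCountingSetOfNormLE_of_isStrongSimulation hs hS⟩,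
    fun _ _ hn => counterRBN_cover_iff hn, counterRBN_exceeds, not_stronglySimulates_rbnModel,
    not_stronglySimulates_asmsModel⟩
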